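/- Let $(X,\mathcal A,\mu,T)$ be an ergodic probability preserving system, i.e. $\mu$ is a probability measure on $(X,\mathcal A)$ and $T:X\to X$ is measurable, $\mu$-preserving and ergodic. For $A\in\mathcal A$ with $\mu(A)>0$ let $\varphi_A(x)=\inf\{n\ge 1: T^nx\in A\}\in\{1,2,\dots,\infty\}$ be the first hitting time of $A$, $T_Ax=T^{\varphi_A(x)}x$ (defined for a.e. $x$) the first entrance map, $\Phi_A=(\varphi_A,\varphi_A\circ T_A,\varphi_A\circ T_A^2,\dots)$ the hitting-time process, and $\mu_A(B)=\mu(A\cap B)/\mu(A)$; more generally, $\nu_B(\cdot)=\nu(B\cap\cdot)/\nu(B)$ for a probability measure $\nu$ and $B\in\mathcal A$ with $\nu(B)>0$. Let $\mathfrak P$ be the set of probability measures $\nu\ll\mu$ on $(X,\mathcal A)$, with the total variation distance $d_{\mathfrak P}(\nu,\nu')=2\sup_{B\in\mathcal A}|\nu(B)-\nu'(B)|$. For a map $\tau:X\to\mathbb N_0$ let $T^\tau x=T^{\tau(x)}x$, and denote push-forwards by a lower star. Let $(A_l)_{l\ge1}$ be measurable sets with $0<\mu(A_l)\to0$, and let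 $A_l=A_l^\bullet\cup A_l^\circ$ be a decomposition into disjoint measurable sets such that $\mu_{A_l}(A_l^\circ)\to\theta$ for some $\theta\in(0,1)$. For a sequence $(\nu_l)$ in $\mathfrak P$, measurable functions $\tau_l:X\to\mathbb N_0$ and a set $\mathfrak K\subseteq\mathfrak P$, write $\nu_l^\circ=(\nu_l)_{A_l^\circ}$ and $\nu_l^\bullet=(\nu_l)_{A_l^\bullet}$, and consider the conditions 1. $\mu(A_l)\,\tau_l\to0$ in probability under $\nu_l$, that is, $\nu_l(\mu(A_l)\tau_l\ge\delta)\to0$ for every $\delta>0$; 2. $\nu_l^\circ(\tau_l<\varphi_{A_l})\to1$; 3. $T^{\tau_l}_*\nu_l^\circ\in\mathfrak K$ for all $l$ for which $\nu_l^\circ$ is defined, i.e. $\nu_l(A_l^\circ)>0$; 4. $\nu_l^\bullet(\tau_l\ge\varphi_{A_l})\to1$; 5. $d_{\mathfrak P}\big((T_{A_l})_*\nu_l^\bullet,\mu_{A_l}\big)\to0$ as $l\to\infty$ (conditions 2, 4 and 5 include that the conditional measures in them are defined for all large $l$). **Theorem.** (a) If there are measurable $\tau_l:X\to\mathbb N_0$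 and a compact $\mathfrak K\subseteq(\mathfrak P,d_{\mathfrak P})$ such that conditions 1–5 hold for $\nu_l=\mu_{A_l}$, then, as $l\to\infty$, the normalized return-time process $\mu(A_l)\Phi_{A_l}$ under $\mu_{A_l}$ converges in distribution in $[0,\infty]^{\mathbb N_0}$ (product topology) to an iid sequence $\widetilde\Phi_{(\mathrm{Exp},\theta)}$ of random variables, each with distribution function $\widetilde F_{(\mathrm{Exp},\theta)}(t)=(1-\theta)+\theta(1-e^{-\theta t})$, $t\ge0$. (b) More generally, the same conclusion holds if for every $\varepsilon>0$ there are a sequence $(\nu_l)$ in $\mathfrak P$ with $d_{\mathfrak P}(\nu_l,\mu_{A_l})<\varepsilon$ for all $l$, a compact $\mathfrak K\subseteq\mathfrak P$ and measurable $\tau_l:X\to\mathbb N_0$ such that conditions 1–5 hold. -/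

import Mathlib

open MeasureTheory ProbabilityTheory Filter Topology
open scoped ENNReal

namespace RareEvents

noncomputable section

section Dynamics

variable {X : Type*}

/-- The first hitting time `φ_A(x) = inf {n ≥ 1 : Tⁿ x ∈ A}`, with value `∞` if the orbit of `x`
never visits `A` at a positive time. -/
def hitTime (T : X → X) (A : Set X) (x : X) : ℕ∞ :=
  ⨅ (n : ℕ) (_ : 1 ≤ n ∧ T^[n] x ∈ A), (n : ℕ∞)

/-- The induced map `T^τ x = T^{τ(x)} x` of a time `τ`. -/
def inducedMap (T : X → X) (τ : X → ℕ) (x : X) : X := T^[τ x] x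

/-- The first entrance map `T_A x = T^{φ_A(x)} x`. Where `φ_A(x) = ∞` (a null set in the ergodic
case) it takes the irrelevant value `x`. -/
def entranceMap (T : X → X) (A : Set X) : X → X :=
  inducedMap T fun x => (hitTime T A x).toNat

/-- The hitting-time process `Φ_A = (φ_A, φ_A ∘ T_A, φ_A ∘ T_A², …)` with values in `[0,∞]^ℕ`. -/
def hitProcess (T : X → X) (A : Set X) (x : X) : ℕ → ℝ≥0∞ :=
  fun j => ((hitTime T A ((entranceMap T A)^[j] x) : ℕ∞) : ℝ≥0∞)

end Dynamics

section Measures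

variable {X : Type*} [MeasurableSpace X]

/-- The normalized process `μ(A) Φ_A`. -/
def scaledHitProcess (μ : Measure X) (T : X → X) (A : Set X) (x : X) : ℕ → ℝ≥0∞ :=
  fun j => μ A * hitProcess T A x j

/-- A sequence of asymptotically rare events: measurable sets with `0 < μ(A_l) → 0`. -/
structure IsRareSequence (μ : Measure X) (A : ℕ → Set X) : Prop where
  measurableSet : ∀ l, MeasurableSet (A l)
  pos : ∀ l, μ (A l) ≠ 0
  tendsto_zero : Tendsto (fun l => μ (A l)) atTop (𝓝 0)

/-- Total variation distance `2 sup_A |ν(A) - ν'(A)|`, the supremum being over measurable sets. -/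
def tvDist (ν ν' : Measure X) : ℝ :=
  2 * ⨆ s : {s : Set X // MeasurableSet s}, |ν.real s.1 - ν'.real s.1|

/-- The set `𝔓` of all probability measures that are absolutely continuous w.r.t. `μ`. -/
def AbsContProb (μ : Measure X) : Type _ :=
  {ν : Measure X // IsProbabilityMeasure ν ∧ ν ≪ μ}

/-- The measure underlying an element of `𝔓`. -/
def AbsContProb.toMeasure {μ : Measure X} (ν : AbsContProb μ) : Measure X := ν.1

instance AbsContProb.instIsProbabilityMeasure {μ : Measure X} (ν : AbsContProb μ) :
    IsProbabilityMeasure ν.toMeasure := ν.2.1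

/-- The measure `μ_A = μ(A ∩ ·)/μ(A)`, as an element of `𝔓`. -/
def condProb (μ : Measure X) [IsFiniteMeasure μ] (A : Set X) (hA : μ A ≠ 0) : AbsContProb μ :=
  ⟨μ[|A], cond_isProbabilityMeasure hA, cond_absolutelyContinuous⟩

theorem bddAbove_abs_sub (ν ν' : Measure X) [IsProbabilityMeasure ν] [IsProbabilityMeasure ν'] :
    BddAbove (Set.range fun s : {s : Set X // MeasurableSet s} => |ν.real s.1 - ν'.real s.1|) := by
  refine ⟨1, ?_⟩
  rintro _ ⟨s, rfl⟩
  have h1 : ν.real s.1 ≤ 1 := measureReal_le_one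
  have h2 : ν'.real s.1 ≤ 1 := measureReal_le_one
  have h3 : 0 ≤ ν.real s.1 := measureReal_nonneg
  have h4 : 0 ≤ ν'.real s.1 := measureReal_nonneg
  exact abs_le.2 ⟨by linarith, by linarith⟩

/-- `𝔓` with the total variation distance. -/
instance AbsContProb.instMetricSpace (μ : Measure X) : MetricSpace (AbsContProb μ) where
  dist ν ν' := tvDist ν.toMeasure ν'.toMeasure
  dist_self ν := by simp [tvDist]
  dist_comm ν ν' := by simp only [tvDist, abs_sub_comm]
  dist_triangle ν κ ρ := by
    simp only [tvDist]
    rw [← mul_add]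
    refine mul_le_mul_of_nonneg_left ?_ zero_le_two
    have : Nonempty {s : Set X // MeasurableSet s} := ⟨⟨∅, MeasurableSet.empty⟩⟩
    refine ciSup_le fun s => (abs_sub_le _ (κ.toMeasure.real s.1) _).trans (add_le_add ?_ ?_)
    · exact le_ciSup (bddAbove_abs_sub ν.toMeasure κ.toMeasure) s
    · exact le_ciSup (bddAbove_abs_sub κ.toMeasure ρ.toMeasure) s
  eq_of_dist_eq_zero {ν κ} h := by
    have h0 : (⨆ s : {s : Set X // MeasurableSet s},
        |ν.toMeasure.real s.1 - κ.toMeasure.real s.1|) = 0 := by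
      have h' : tvDist ν.toMeasure κ.toMeasure = 0 := h
      simpa [tvDist] using h'
    refine Subtype.ext (Measure.ext fun s hs => ?_)
    have h1 := le_ciSup (bddAbove_abs_sub ν.toMeasure κ.toMeasure) ⟨s, hs⟩
    rw [h0] at h1
    have h2 : ν.toMeasure.real s = κ.toMeasure.real s :=
      sub_eq_zero.1 (abs_eq_zero.1 (le_antisymm h1 (abs_nonneg _)))
    exact (measureReal_eq_measureReal_iff (measure_ne_top ν.toMeasure s)
      (measure_ne_top κ.toMeasure s)).1 h2

/-- The conditions on the splitting `A_l = A_l^• ∪ A_l^∘` (here `Aret l` and `Aesc l`), relative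
to initial measures `ν_l`, times `τ_l` and a subset `𝔎` of `𝔓`. The conditional measures
`(ν_l)_{A_l^∘}` and `(ν_l)_{A_l^•}` are `(ν l)[|Aesc l]` and `(ν l)[|Aret l]`. -/
structure SplitDelayConditions (μ : Measure X) (T : X → X) (A Aret Aesc : ℕ → Set X)
    (ν : ℕ → Measure X) (τ : ℕ → X → ℕ) (𝔎 : Set (AbsContProb μ)) : Prop where
  measurable_time : ∀ l, Measurable (τ l)
  /-- `μ(A_l) τ_l → 0` in probability under `ν_l` -/
  time_negligible : ∀ δ : ℝ, 0 < δ →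
    Tendsto (fun l => ν l {x | δ ≤ μ.real (A l) * (τ l x : ℝ)}) atTop (𝓝 0)
  /-- `ν_l^∘(τ_l < φ_{A_l}) → 1` -/
  escape : Tendsto (fun l => (ν l)[|Aesc l] {x | (τ l x : ℕ∞) < hitTime T (A l) x}) atTop (𝓝 1)
  /-- `T^{τ_l}_* ν_l^∘ ∈ 𝔎` whenever `ν_l^∘` is defined -/
  mem_compact : ∀ l, ν l (Aesc l) ≠ 0 →
    ∃ κ ∈ 𝔎, κ.toMeasure = ((ν l)[|Aesc l]).map (inducedMap T (τ l))
  /-- `ν_l^•(τ_l ≥ φ_{A_l}) → 1` -/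
  early_return :
    Tendsto (fun l => (ν l)[|Aret l] {x | hitTime T (A l) x ≤ (τ l x : ℕ∞)}) atTop (𝓝 1)
  /-- `d_𝔓((T_{A_l})_* ν_l^•, μ_{A_l}) → 0` -/
  return_image :
    Tendsto (fun l => tvDist (((ν l)[|Aret l]).map (entranceMap T (A l))) (μ[|A l])) atTop (𝓝 0)

end Measures

section Limit

/-- The distribution function `(1 - θ) + θ (1 - e^{-θ t})`, `t ≥ 0`. -/
def compoundExpCDF (θ t : ℝ) : ℝ := (1 - θ) + θ * (1 - Real.exp (-(θ * t)))

/-- `Φ = (Φ_0, Φ_1, …)` is an iid sequence of random variables in `[0,∞]`, each with distribution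
function `compoundExpCDF θ` on `[0,∞)`. -/
structure IsIIDCompoundExp {Ω : Type*} [MeasurableSpace Ω] (P : Measure Ω) (θ : ℝ)
    (Φ : Ω → ℕ → ℝ≥0∞) : Prop where
  measurable : ∀ j, Measurable fun ω => Φ ω j
  indep : iIndepFun (fun j ω => Φ ω j) P
  cdf_eq : ∀ j, ∀ t : ℝ, 0 ≤ t →
    P {ω | Φ ω j ≤ ENNReal.ofReal t} = ENNReal.ofReal (compoundExpCDF θ t)

/-- Such iid sequences exist. -/
theorem exists_isIIDCompoundExp {θ : ℝ} (hθ : θ ∈ Set.Ioo (0 : ℝ) 1) :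
    ∃ (P : Measure (ℕ → ℝ≥0∞)), IsProbabilityMeasure P ∧ IsIIDCompoundExp P θ id := by
  obtain ⟨h0, h1⟩ := hθ
  have := isProbabilityMeasure_expMeasure h0
  let E : Measure ℝ≥0∞ := (expMeasure θ).map ENNReal.ofReal
  have : IsProbabilityMeasure E :=
    Measure.isProbabilityMeasure_map ENNReal.measurable_ofReal.aemeasurable
  let m : Measure ℝ≥0∞ :=
    ENNReal.ofReal (1 - θ) • Measure.dirac 0 + ENNReal.ofReal θ • E
  have hm : IsProbabilityMeasure m := ⟨by
    simp only [m, Measure.add_apply, Measure.smul_apply, measure_univ, smul_eq_mul, mul_one]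
    rw [← ENNReal.ofReal_add (by linarith) h0.le]
    simp⟩
  have hcdf : ∀ t : ℝ, 0 ≤ t →
      m (Set.Iic (ENNReal.ofReal t)) = ENNReal.ofReal (compoundExpCDF θ t) := by
    intro t ht
    have hE : E (Set.Iic (ENNReal.ofReal t)) = ENNReal.ofReal (1 - Real.exp (-(θ * t))) := by
      have hpre : ENNReal.ofReal ⁻¹' Set.Iic (ENNReal.ofReal t) = Set.Iic t := by
        ext x
        simp [ENNReal.ofReal_le_ofReal_iff ht]
      rw [Measure.map_apply ENNReal.measurable_ofReal measurableSet_Iic, hpre, ← ofReal_cdf,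
        cdf_expMeasure_eq h0, if_pos ht]
    have he : 0 ≤ 1 - Real.exp (-(θ * t)) := by
      have : Real.exp (-(θ * t)) ≤ 1 :=
        Real.exp_le_one_iff.2 (neg_nonpos.2 (mul_nonneg h0.le ht))
      linarith
    simp only [m, Measure.add_apply, Measure.smul_apply, smul_eq_mul, hE]
    rw [Measure.dirac_apply' _ measurableSet_Iic]
    simp only [Set.indicator, Set.mem_Iic, zero_le, if_true, Pi.one_apply, mul_one]
    rw [← ENNReal.ofReal_mul h0.le, ← ENNReal.ofReal_add (by linarith) (mul_nonneg h0.le he)]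
    rfl
  refine ⟨Measure.infinitePi fun _ : ℕ => m, inferInstance, ?_, ?_, ?_⟩
  · intro j
    exact measurable_pi_apply j
  · exact iIndepFun_infinitePi (X := fun _ => id) (fun _ => measurable_id)
  · intro j t ht
    have hmap := Measure.infinitePi_map_eval (fun _ : ℕ => m) j
    have hset := congrArg (fun κ : Measure ℝ≥0∞ => κ (Set.Iic (ENNReal.ofReal t))) hmap
    simp only [Measure.map_apply (measurable_pi_apply j) measurableSet_Iic] at hset
    rw [← hcdf t ht]
    exact hset

end Limit

end

end RareEvents

/-! Convergence is tested with mixed Laplace transforms. On the compact space `[0,∞]^ℕ` the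
monomials `expMonomial` span a point-separating algebra, so by Stone–Weierstrass their integrals
determine weak limits (`tendsto_of_tendsto_integral_expMonomial`). Since `Φ_A` satisfies `Φ_A =
(φ_A, Φ_A ∘ T_A)`, such a monomial is of the form `H = e^{-k μ(A) φ_A} · W ∘ T_A`, where `W` is a
monomial in one coordinate fewer. The claim thus reduces to showing that passing from `W` to `H`
multiplies the limit under `μ_A` by the one-dimensional transform `(1-θ) + θ · θ/(θ+k)`.

Write `p = ∫ H dμ_A`, `q = ∫ H dμ`, `v = ∫ W dμ_A`. Two linear relations determine the limit of `p`.
Invariance of `μ` gives a Kac-type identity `p = v - c q` with `c = (e^{kμ(A)} - 1)/μ(A) → k`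
(`exp_sub_one_mul_integral_entranceTransform`). The splitting gives `p ≈ (1-θ) v + θ q`
(`SplitDelayConditions.eventually_abs_le`). Together `q → θ v/(θ+k)`, and `p` follows.

For the second relation, on the returning part the time elapsed until the entrance is negligible, so
`H ≈ W ∘ T_A`, and the law of `T_A` is close to `μ_A`. On the escaping part `H ≈ H ∘ T^τ`, whose
starting law lies in a compact set. There `H` has integral close to `q`: the functions `H` are
asymptotically `T`-invariant, ergodicity makes such functions converge weakly to their means, and
compactness in total variation makes this uniform. -/

namespace RareEvents

noncomputable section

/-! ### The exponential `e^{-x}` on the extended half-line. -/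

section ExpNeg

/-- The function `x ↦ e^{-x}` on `[0,∞]`, with value `0` at `∞`. -/
def expNeg (x : ℝ≥0∞) : ℝ := (EReal.exp (-(x : EReal))).toReal

@[simp] lemma expNeg_top : expNeg ∞ = 0 := by simp [expNeg]

@[simp] lemma expNeg_zero : expNeg 0 = 1 := by simp [expNeg]

lemma expNeg_ofReal {x : ℝ} (hx : 0 ≤ x) : expNeg (ENNReal.ofReal x) = Real.exp (-x) := by
  rw [expNeg, EReal.coe_ennreal_ofReal, max_eq_left hx, ← EReal.coe_neg, EReal.exp_coe,
    ENNReal.toReal_ofReal (Real.exp_pos _).le]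

lemma expNeg_of_ne_top {x : ℝ≥0∞} (hx : x ≠ ∞) : expNeg x = Real.exp (-x.toReal) := by
  rw [← expNeg_ofReal ENNReal.toReal_nonneg, ENNReal.ofReal_toReal hx]

lemma expNeg_nonneg (x : ℝ≥0∞) : 0 ≤ expNeg x := ENNReal.toReal_nonneg

lemma expNeg_le_one (x : ℝ≥0∞) : expNeg x ≤ 1 := by
  induction x with
  | top => simp
  | coe x => simp [expNeg_of_ne_top]

lemma expNeg_pow_mem (x : ℝ≥0∞) (k : ℕ) : expNeg x ^ k ∈ Set.Icc (0 : ℝ) 1 :=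
  ⟨pow_nonneg (expNeg_nonneg x) k, pow_le_one₀ (expNeg_nonneg x) (expNeg_le_one x)⟩

lemma expNeg_add (x y : ℝ≥0∞) : expNeg (x + y) = expNeg x * expNeg y := by
  induction x with
  | top => simp
  | coe x =>
    induction y with
    | top => simp
    | coe y =>
      rw [← ENNReal.coe_add, expNeg_of_ne_top ENNReal.coe_ne_top,
        expNeg_of_ne_top ENNReal.coe_ne_top, expNeg_of_ne_top ENNReal.coe_ne_top, ← Real.exp_add]
      congr 1
      rw [ENNReal.coe_add, ENNReal.toReal_add ENNReal.coe_ne_top ENNReal.coe_ne_top]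
      ring

lemma one_sub_expNeg_pow_le {x : ℝ≥0∞} {t : ℝ} (ht : 0 ≤ t) (hx : x ≤ ENNReal.ofReal t) (k : ℕ) :
    1 - expNeg x ^ k ≤ k * t := by
  have hx' : x ≠ ∞ := ne_top_of_le_ne_top ENNReal.ofReal_ne_top hx
  have h1 : x.toReal ≤ t := ENNReal.toReal_le_of_le_ofReal ht hx
  rw [expNeg_of_ne_top hx', ← Real.exp_nat_mul]
  have h2 := Real.add_one_le_exp ((k : ℝ) * -x.toReal)
  have h3 : (k : ℝ) * x.toReal ≤ k * t := by gcongr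
  linarith

lemma expNeg_injective : Function.Injective expNeg := by
  intro x y h
  have hfin : ∀ z : ℝ≥0∞, EReal.exp (-(z : EReal)) ≠ ∞ := fun z => by
    rw [Ne, EReal.exp_eq_top_iff, EReal.neg_eq_top_iff]
    exact EReal.coe_ennreal_ne_bot z
  have h1 := (ENNReal.toReal_eq_toReal_iff' (hfin x) (hfin y)).1 h
  exact EReal.coe_ennreal_injective (neg_injective (EReal.exp_strictMono.injective h1))

lemma continuous_expNeg : Continuous expNeg := by
  have h1 : Continuous fun x : ℝ≥0∞ => EReal.exp (-(x : EReal)) :=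
    ENNReal.continuous_exp.comp (continuous_neg.comp continuous_coe_ennreal_ereal)
  refine continuous_iff_continuousAt.2 fun x => ?_
  refine (ENNReal.tendsto_toReal ?_).comp h1.continuousAt
  rw [Ne, EReal.exp_eq_top_iff, EReal.neg_eq_top_iff]
  exact EReal.coe_ennreal_ne_bot x

lemma measurable_expNeg : Measurable expNeg := continuous_expNeg.measurable

end ExpNeg

/-! ### Laplace transforms determine weak convergence on `[0,∞]^ℕ`. -/

section Criterion

/-- The coordinate functions `x ↦ e^{-x_j}` on `[0,∞]^ℕ`. -/
def expNegCoord (j : ℕ) : C(ℕ → ℝ≥0∞, ℝ) :=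
  ⟨fun x => expNeg (x j), continuous_expNeg.comp (continuous_apply j)⟩

/-- The monomials `x ↦ ∏_{j < d} e^{-k_j x_j}` on `[0,∞]^ℕ`. -/
def expMonomial (d : ℕ) (k : ℕ → ℕ) (x : ℕ → ℝ≥0∞) : ℝ :=
  ∏ j ∈ Finset.range d, expNeg (x j) ^ k j

lemma continuous_expMonomial (d : ℕ) (k : ℕ → ℕ) : Continuous (expMonomial d k) :=
  continuous_finsetProd _ fun j _ => (continuous_expNeg.comp (continuous_apply j)).pow _

lemma expMonomial_mem_Icc (d : ℕ) (k : ℕ → ℕ) (x : ℕ → ℝ≥0∞) :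
    expMonomial d k x ∈ Set.Icc (0 : ℝ) 1 :=
  ⟨Finset.prod_nonneg fun _ _ => (expNeg_pow_mem _ _).1,
    Finset.prod_le_one (fun _ _ => (expNeg_pow_mem _ _).1) fun _ _ => (expNeg_pow_mem _ _).2⟩

/-- The algebra generated by the coordinates is the linear span of this monoid, so by linearity it
suffices to know the limits for monomials. -/
lemma exists_expMonomial_of_mem_closure {f : C(ℕ → ℝ≥0∞, ℝ)}
    (hf : f ∈ Submonoid.closure (Set.range expNegCoord)) :
    ∃ d k, ∀ x, f x = expMonomial d k x := by
  have h : ∃ k : ℕ →₀ ℕ, ∀ x, f x = k.prod fun j n => expNeg (x j) ^ n := by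
    induction hf using Submonoid.closure_induction with
    | mem f hf =>
      obtain ⟨j, rfl⟩ := hf
      exact ⟨Finsupp.single j 1, fun x => by simp [expNegCoord]⟩
    | one => exact ⟨0, fun x => by simp⟩
    | mul f g _ _ hf hg =>
      obtain ⟨k, hk⟩ := hf
      obtain ⟨m, hm⟩ := hg
      refine ⟨k + m, fun x => ?_⟩
      rw [Finsupp.prod_add_index' (by simp) (by intros; rw [pow_add])]
      simp [hk, hm]
  obtain ⟨k, hk⟩ := h
  obtain ⟨d, hd⟩ := k.support.exists_nat_subset_range
  refine ⟨d, k, fun x => ?_⟩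
  rw [hk, Finsupp.prod_of_support_subset _ hd _ (by simp)]
  rfl

/-- On `[0,∞]^ℕ`, convergence of all mixed Laplace transforms with integer parameters implies weak
convergence. -/
theorem tendsto_of_tendsto_integral_expMonomial
    {ρ : ℕ → ProbabilityMeasure (ℕ → ℝ≥0∞)} {ρ' : ProbabilityMeasure (ℕ → ℝ≥0∞)}
    (h : ∀ d k, Tendsto (fun l => ∫ x, expMonomial d k x ∂(ρ l : Measure (ℕ → ℝ≥0∞))) atTop
      (𝓝 (∫ x, expMonomial d k x ∂(ρ' : Measure (ℕ → ℝ≥0∞))))) :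
    Tendsto ρ atTop (𝓝 ρ') := by
  have hint : ∀ (κ : ProbabilityMeasure (ℕ → ℝ≥0∞)) (f : C(ℕ → ℝ≥0∞, ℝ)),
      Integrable f (κ : Measure (ℕ → ℝ≥0∞)) := fun κ f =>
    (BoundedContinuousFunction.mkOfCompact f).integrable _
  have hdist : ∀ (κ : ProbabilityMeasure (ℕ → ℝ≥0∞)) (f g : C(ℕ → ℝ≥0∞, ℝ)),
      |∫ x, f x ∂(κ : Measure (ℕ → ℝ≥0∞)) - ∫ x, g x ∂(κ : Measure (ℕ → ℝ≥0∞))| ≤ dist f g := by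
    intro κ f g
    rw [← integral_sub (hint κ f) (hint κ g)]
    have h1 := norm_integral_le_of_norm_le_const (μ := (κ : Measure (ℕ → ℝ≥0∞)))
      (f := fun x => f x - g x) (C := dist f g) (Eventually.of_forall fun x => by
        rw [Real.norm_eq_abs, ← Real.dist_eq]
        exact ContinuousMap.dist_apply_le_dist x)
    rwa [probReal_univ, mul_one] at h1
  let 𝓐 : Subalgebra ℝ C(ℕ → ℝ≥0∞, ℝ) := Algebra.adjoin ℝ (Set.range expNegCoord)
  have hsep : 𝓐.SeparatesPoints := by
    intro x y hxy
    obtain ⟨j, hj⟩ := Function.ne_iff.1 hxy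
    exact ⟨expNegCoord j, ⟨expNegCoord j, Algebra.subset_adjoin ⟨j, rfl⟩, rfl⟩,
      fun h => hj (expNeg_injective h)⟩
  have hspan : ∀ f ∈ 𝓐, Tendsto (fun l => ∫ x, f x ∂(ρ l : Measure (ℕ → ℝ≥0∞))) atTop
      (𝓝 (∫ x, f x ∂(ρ' : Measure (ℕ → ℝ≥0∞)))) := by
    intro f hf
    have hf' : f ∈ Submodule.span ℝ
        (Submonoid.closure (Set.range expNegCoord) : Set C(ℕ → ℝ≥0∞, ℝ)) := by
      rw [← Algebra.adjoin_eq_span]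
      exact hf
    clear hf
    induction hf' using Submodule.span_induction with
    | mem f hf =>
      obtain ⟨d, k, hk⟩ := exists_expMonomial_of_mem_closure hf
      simpa only [hk] using h d k
    | zero => simp
    | add f g _ _ hf hg =>
      simp only [ContinuousMap.add_apply]
      simpa only [integral_add (hint _ f) (hint _ g)] using hf.add hg
    | smul c f _ hf =>
      simp only [ContinuousMap.smul_apply, integral_smul]
      exact hf.const_smul c
  rw [ProbabilityMeasure.tendsto_iff_forall_integral_tendsto]
  intro f
  rw [Metric.tendsto_atTop]
  intro ε hε
  -- Stone–Weierstrass applies to all bounded continuous functions because `[0,∞]^ℕ` is compact; no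
  -- tightness argument is needed.
  have hmem : f.toContinuousMap ∈ closure (𝓐 : Set C(ℕ → ℝ≥0∞, ℝ)) := by
    rw [← Subalgebra.topologicalClosure_coe,
      ContinuousMap.subalgebra_topologicalClosure_eq_top_of_separatesPoints 𝓐 hsep]
    trivial
  obtain ⟨g, hg, hfg⟩ := Metric.mem_closure_iff.1 hmem (ε / 3) (by positivity)
  obtain ⟨N, hN⟩ := Metric.tendsto_atTop.1 (hspan g hg) (ε / 3) (by positivity)
  refine ⟨N, fun l hl => ?_⟩
  have h1 := hdist (ρ l) f.toContinuousMap g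
  have h2 := hdist ρ' f.toContinuousMap g
  have h3 := hN l hl
  rw [Real.dist_eq] at h3 ⊢
  simp only [BoundedContinuousFunction.coe_toContinuousMap] at h1 h2
  rw [abs_le] at h1 h2
  rw [abs_lt] at h3 ⊢
  constructor <;> linarith

end Criterion

/-! ### Mixed Laplace transforms of the iid limit process. -/

section LimitMoments

/-- The Laplace transform `(1 - θ) + θ · θ / (θ + k)` of the limit law. -/
def compoundExpLaplace (θ : ℝ) (k : ℕ) : ℝ := (1 - θ) + θ * (θ / (θ + k))

lemma integral_exp_neg_pow_expMeasure {θ : ℝ} (hθ : 0 < θ) (k : ℕ) :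
    ∫ x, expNeg (ENNReal.ofReal x) ^ k ∂(expMeasure θ) = θ / (θ + k) := by
  have hpos : 0 < θ + k := by positivity
  have hdens : expMeasure θ = volume.withDensity (exponentialPDF θ) := rfl
  have hmeas : Measurable (exponentialPDF θ) :=
    (measurable_exponentialPDFReal θ).ennreal_ofReal
  rw [hdens, integral_withDensity_eq_integral_toReal_smul hmeas
    (Eventually.of_forall fun x => ENNReal.ofReal_lt_top)]
  have hfun : (fun x => (exponentialPDF θ x).toReal • expNeg (ENNReal.ofReal x) ^ k) =
      (Set.Ici 0).indicator fun x => θ * Real.exp (-(θ + k) * x) := by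
    ext x
    by_cases hx : 0 ≤ x
    · rw [Set.indicator_of_mem (by exact hx), exponentialPDF_of_nonneg hx, expNeg_ofReal hx,
        ENNReal.toReal_ofReal (by positivity), ← Real.exp_nat_mul, smul_eq_mul, mul_assoc,
        ← Real.exp_add]
      congr 2
      ring
    · rw [Set.indicator_of_notMem (by exact hx), exponentialPDF_of_neg (not_le.1 hx)]
      simp
  rw [hfun, integral_indicator measurableSet_Ici, integral_Ici_eq_integral_Ioi,
    integral_const_mul, integral_exp_mul_Ioi (by linarith)]
  simp only [mul_zero, Real.exp_zero]
  field_simp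

lemma IsIIDCompoundExp.map_eq {Ω : Type*} [MeasurableSpace Ω] {P : Measure Ω}
    [IsProbabilityMeasure P] {θ : ℝ} (hθ : θ ∈ Set.Ioo (0 : ℝ) 1) {Φ : Ω → ℕ → ℝ≥0∞}
    (hΦ : IsIIDCompoundExp P θ Φ) (j : ℕ) :
    P.map (fun ω => Φ ω j) = ENNReal.ofReal (1 - θ) • Measure.dirac 0 +
      ENNReal.ofReal θ • (expMeasure θ).map ENNReal.ofReal := by
  obtain ⟨h0, h1⟩ := hθ
  have := isProbabilityMeasure_expMeasure h0
  have := Measure.isProbabilityMeasure_map (μ := expMeasure θ)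
    ENNReal.measurable_ofReal.aemeasurable
  have := Measure.isProbabilityMeasure_map (μ := P) (hΦ.measurable j).aemeasurable
  refine Measure.ext_of_Iic _ _ fun a => ?_
  induction a with
  -- The hypothesis `cdf_eq` concerns finite levels only; at `∞` both sides have total mass one.
  | top =>
    simp only [Set.Iic_top, measure_univ, Measure.add_apply, Measure.smul_apply, smul_eq_mul,
      mul_one]
    rw [← ENNReal.ofReal_add (by linarith) h0.le]
    simp
  | coe a =>
    obtain ⟨t, ht, hta⟩ : ∃ t : ℝ, 0 ≤ t ∧ ENNReal.ofReal t = a :=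
      ⟨a, a.2, by simp⟩
    rw [← hta]
    have hpre : ENNReal.ofReal ⁻¹' Set.Iic (ENNReal.ofReal t) = Set.Iic t := by
      ext x
      simp [ENNReal.ofReal_le_ofReal_iff ht]
    have he : 0 ≤ 1 - Real.exp (-(θ * t)) := by
      have : Real.exp (-(θ * t)) ≤ 1 :=
        Real.exp_le_one_iff.2 (neg_nonpos.2 (mul_nonneg h0.le ht))
      linarith
    rw [Measure.map_apply (hΦ.measurable j) measurableSet_Iic]
    change P {ω | Φ ω j ≤ ENNReal.ofReal t} = _
    rw [hΦ.cdf_eq j t ht]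
    simp only [Measure.add_apply, Measure.smul_apply, smul_eq_mul]
    rw [Measure.map_apply ENNReal.measurable_ofReal measurableSet_Iic, hpre, ← ofReal_cdf,
      cdf_expMeasure_eq h0, if_pos ht, Measure.dirac_apply' _ measurableSet_Iic]
    simp only [Set.indicator, Set.mem_Iic, zero_le, if_true, Pi.one_apply, mul_one]
    rw [← ENNReal.ofReal_mul h0.le, ← ENNReal.ofReal_add (by linarith) (mul_nonneg h0.le he)]
    rfl

lemma IsIIDCompoundExp.integral_expNeg_pow {Ω : Type*} [MeasurableSpace Ω] {P : Measure Ω}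
    [IsProbabilityMeasure P] {θ : ℝ} (hθ : θ ∈ Set.Ioo (0 : ℝ) 1) {Φ : Ω → ℕ → ℝ≥0∞}
    (hΦ : IsIIDCompoundExp P θ Φ) (j k : ℕ) :
    ∫ ω, expNeg (Φ ω j) ^ k ∂P = compoundExpLaplace θ k := by
  have := isProbabilityMeasure_expMeasure hθ.1
  have := Measure.isProbabilityMeasure_map (μ := expMeasure θ)
    ENNReal.measurable_ofReal.aemeasurable
  have hm : Measurable fun x => expNeg x ^ k := measurable_expNeg.pow_const k
  have hint : ∀ (ρ : Measure ℝ≥0∞) [IsFiniteMeasure ρ], Integrable (fun x => expNeg x ^ k) ρ :=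
    fun ρ _ => Integrable.of_bound hm.aestronglyMeasurable 1 (Eventually.of_forall fun x => by
      rw [Real.norm_of_nonneg (expNeg_pow_mem x k).1]
      exact (expNeg_pow_mem x k).2)
  rw [← integral_map (f := fun x => expNeg x ^ k) (hΦ.measurable j).aemeasurable
    hm.aestronglyMeasurable, hΦ.map_eq hθ,
    integral_add_measure ((hint _).smul_measure ENNReal.ofReal_ne_top)
      ((hint _).smul_measure ENNReal.ofReal_ne_top),
    integral_smul_measure, integral_smul_measure, integral_dirac,
    integral_map ENNReal.measurable_ofReal.aemeasurable hm.aestronglyMeasurable,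
    integral_exp_neg_pow_expMeasure hθ.1, ENNReal.toReal_ofReal (by linarith [hθ.2]),
    ENNReal.toReal_ofReal hθ.1.le]
  simp [compoundExpLaplace]

lemma IsIIDCompoundExp.integral_expMonomial {Ω : Type*} [MeasurableSpace Ω] {P : Measure Ω}
    [IsProbabilityMeasure P] {θ : ℝ} (hθ : θ ∈ Set.Ioo (0 : ℝ) 1) {Φ : Ω → ℕ → ℝ≥0∞}
    (hΦ : IsIIDCompoundExp P θ Φ) (d : ℕ) (k : ℕ → ℕ) :
    ∫ ω, expMonomial d k (Φ ω) ∂P = ∏ j ∈ Finset.range d, compoundExpLaplace θ (k j) := by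
  -- The product formula is for finite families, so independence is restricted to the first `d`
  -- coordinates.
  have hind := hΦ.indep.precomp (g := fun i : Fin d => (i : ℕ)) Fin.val_injective
  have h := hind.integral_fun_prod_comp (f := fun (i : Fin d) x => expNeg x ^ k i)
    (fun i => (hΦ.measurable i).aemeasurable)
    (fun i => (measurable_expNeg.pow_const _).aestronglyMeasurable)
  simp only [expMonomial, Finset.prod_range]
  rw [h]
  exact Finset.prod_congr rfl fun i _ => hΦ.integral_expNeg_pow hθ i (k i)

end LimitMoments

/-! ### Total variation bounds for integrals of `[0,1]`-valued functions. -/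

section TotalVariation

variable {X : Type*} [MeasurableSpace X]

lemma integrable_of_mem_Icc {ν : Measure X} [IsFiniteMeasure ν] {f : X → ℝ} (hf : Measurable f)
    (h01 : ∀ x, f x ∈ Set.Icc (0 : ℝ) 1) : Integrable f ν :=
  Integrable.of_bound hf.aestronglyMeasurable 1 (Eventually.of_forall fun x => by
    rw [Real.norm_of_nonneg (h01 x).1]
    exact (h01 x).2)

lemma integral_mem_Icc {ν : Measure X} [IsProbabilityMeasure ν] {f : X → ℝ} (hf : Measurable f)
    (h01 : ∀ x, f x ∈ Set.Icc (0 : ℝ) 1) : ∫ x, f x ∂ν ∈ Set.Icc (0 : ℝ) 1 := by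
  refine ⟨integral_nonneg fun x => (h01 x).1, ?_⟩
  have h := integral_mono (integrable_of_mem_Icc (ν := ν) hf h01) (integrable_const (1 : ℝ))
    fun x => (h01 x).2
  simpa using h

lemma abs_measureReal_sub_le_tvDist (ν ν' : Measure X) [IsProbabilityMeasure ν]
    [IsProbabilityMeasure ν'] {s : Set X} (hs : MeasurableSet s) :
    |ν.real s - ν'.real s| ≤ tvDist ν ν' / 2 := by
  have h := le_ciSup (bddAbove_abs_sub ν ν') ⟨s, hs⟩
  simpa [tvDist] using h

/-- Layer cake: the integral of `f` is the integral over `t ∈ (0,1]` of the measure of `{t ≤ f}`,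
and for each `t` these measures differ by at most half the distance. -/
lemma abs_integral_sub_le_tvDist (ν ν' : Measure X) [IsProbabilityMeasure ν]
    [IsProbabilityMeasure ν'] {f : X → ℝ} (hf : Measurable f)
    (h01 : ∀ x, f x ∈ Set.Icc (0 : ℝ) 1) :
    |∫ x, f x ∂ν - ∫ x, f x ∂ν'| ≤ tvDist ν ν' / 2 := by
  have hlc : ∀ (κ : Measure X) [IsProbabilityMeasure κ],
      ∫ x, f x ∂κ = ∫ t in Set.Ioc (0 : ℝ) 1, κ.real {x | t ≤ f x} := fun κ _ =>
    (integrable_of_mem_Icc hf h01).integral_eq_integral_Ioc_meas_le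
      (Eventually.of_forall fun x => (h01 x).1) (Eventually.of_forall fun x => (h01 x).2)
  have hint : ∀ (κ : Measure X) [IsProbabilityMeasure κ],
      Integrable (fun t : ℝ => κ.real {x | t ≤ f x}) (volume.restrict (Set.Ioc (0 : ℝ) 1)) := by
    intro κ _
    have hanti : Antitone fun t : ℝ => κ.real {x | t ≤ f x} := fun s t hst =>
      measureReal_mono fun x (hx : t ≤ f x) => hst.trans hx
    refine Integrable.of_bound hanti.measurable.aestronglyMeasurable 1
      (Eventually.of_forall fun t => ?_)
    rw [Real.norm_of_nonneg measureReal_nonneg]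
    exact measureReal_le_one
  rw [hlc ν, hlc ν', ← integral_sub (hint ν) (hint ν')]
  have h1 := norm_integral_le_of_norm_le_const (μ := volume.restrict (Set.Ioc (0 : ℝ) 1))
    (f := fun t : ℝ => ν.real {x | t ≤ f x} - ν'.real {x | t ≤ f x}) (C := tvDist ν ν' / 2)
    (Eventually.of_forall fun t =>
      abs_measureReal_sub_le_tvDist ν ν' (measurableSet_le measurable_const hf))
  simpa using h1

end TotalVariation

/-! ### Asymptotically invariant functions converge weakly to their means. -/

section AsymptoticInvariance

/-- A bounded sequence of asymptotically `U`-invariant vectors which is asymptotically orthogonal to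
the fixed vectors of `U` converges weakly to zero. -/
lemma tendsto_inner_of_asymptotically_fixed {H : Type*} [NormedAddCommGroup H]
    [InnerProductSpace ℝ H] [CompleteSpace H] (U : H →L[ℝ] H) (G : ℕ → H) (C : ℝ)
    (hG : ∀ l, ‖G l‖ ≤ C) (hU : Tendsto (fun l => ‖U (G l) - G l‖) atTop (𝓝 0))
    (hfix : ∀ v, U v = v → Tendsto (fun l => inner ℝ v (G l)) atTop (𝓝 0)) (g : H) :
    Tendsto (fun l => inner ℝ g (G l)) atTop (𝓝 0) := by
  let M : Submodule ℝ H :=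
    { carrier := {g | Tendsto (fun l => inner ℝ g (G l)) atTop (𝓝 0)}
      add_mem' := fun {a b} ha hb => by
        simpa [inner_add_left] using Tendsto.add ha hb
      zero_mem' := by simp
      smul_mem' := fun c a ha => by
        simpa [inner_smul_left] using Tendsto.const_mul c ha }
  have hC : 0 ≤ C := (norm_nonneg _).trans (hG 0)
  have hclosed : IsClosed (M : Set H) := by
    refine isClosed_of_closure_subset fun v hv => ?_
    change Tendsto (fun l => inner ℝ v (G l)) atTop (𝓝 0)
    rw [Metric.tendsto_atTop]
    intro ε hε
    obtain ⟨w, hw, hvw⟩ := Metric.mem_closure_iff.1 hv (ε / (2 * (C + 1))) (by positivity)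
    obtain ⟨N, hN⟩ := Metric.tendsto_atTop.1 hw (ε / 2) (by positivity)
    refine ⟨N, fun l hl => ?_⟩
    have h1 := hN l hl
    rw [Real.dist_eq, sub_zero] at h1 ⊢
    have h2 : |inner ℝ (v - w) (G l)| ≤ ε / 2 := by
      refine (abs_real_inner_le_norm _ _).trans ?_
      rw [← dist_eq_norm]
      calc dist v w * ‖G l‖ ≤ ε / (2 * (C + 1)) * (C + 1) := by
            gcongr
            linarith [hG l]
        _ = ε / 2 := by field_simp
    rw [inner_sub_left] at h2
    rw [abs_lt] at h1 ⊢
    rw [abs_le] at h2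
    constructor <;> linarith
  have hcompl : CompleteSpace M := hclosed.completeSpace_coe
  -- Moving the adjoint across, `⟨U* v - v, G⟩ = ⟨v, U G - G⟩`, which tends to zero by asymptotic
  -- invariance.
  have hadj : ∀ v, U.adjoint v - v ∈ M := by
    intro v
    change Tendsto (fun l => inner ℝ (U.adjoint v - v) (G l)) atTop (𝓝 0)
    have h1 : ∀ l, inner ℝ (U.adjoint v - v) (G l) = inner ℝ v (U (G l) - G l) := fun l => by
      rw [inner_sub_left, inner_sub_right, ContinuousLinearMap.adjoint_inner_left]
    simp only [h1]
    refine squeeze_zero_norm (fun l => norm_inner_le_norm _ _) ?_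
    simpa using hU.const_mul ‖v‖
  -- A vector orthogonal to the range of `U* - 1` is fixed by `U`, hence lies in `M` by `hfix`;
  -- being also orthogonal to `M`, it vanishes.
  have hbot : Mᗮ = ⊥ := by
    rw [Submodule.eq_bot_iff]
    intro v hv
    have h1 : U v = v := by
      rw [← sub_eq_zero]
      refine inner_self_eq_zero (𝕜 := ℝ) |>.1 ?_
      have h2 := (Submodule.mem_orthogonal _ _).1 hv _ (hadj (U v - v))
      rwa [inner_sub_left, ContinuousLinearMap.adjoint_inner_left, ← inner_sub_right] at h2
    exact inner_self_eq_zero (𝕜 := ℝ) |>.1 ((Submodule.mem_orthogonal _ _).1 hv v (hfix v h1))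
  have htop : M = ⊤ := Submodule.orthogonal_eq_bot_iff.1 hbot
  have hg : g ∈ M := htop ▸ Submodule.mem_top
  exact hg

variable {X : Type*} [MeasurableSpace X] {μ : Measure X} [IsProbabilityMeasure μ] {T : X → X}

/-- The Hilbert space lemma is applied to the Koopman operator on `L²(μ)` and the centred functions.
By ergodicity its fixed vectors are constants, to which centred functions are orthogonal. -/
lemma tendsto_setIntegral_of_asymptotically_invariant (hT : Ergodic T μ) {f : ℕ → X → ℝ}
    (hf : ∀ l, Measurable (f l)) (h01 : ∀ l x, f l x ∈ Set.Icc (0 : ℝ) 1)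
    (hinv : Tendsto (fun l => ∫ x, |f l (T x) - f l x| ∂μ) atTop (𝓝 0))
    {s : Set X} (hs : MeasurableSet s) :
    Tendsto (fun l => ∫ x in s, (f l x - ∫ y, f l y ∂μ) ∂μ) atTop (𝓝 0) := by
  have hI : ∀ l, ∫ y, f l y ∂μ ∈ Set.Icc (0 : ℝ) 1 := fun l => integral_mem_Icc (hf l) (h01 l)
  have hb : ∀ l x, ‖f l x - ∫ y, f l y ∂μ‖ ≤ 1 := fun l x => by
    rw [Real.norm_eq_abs, abs_le]
    constructor <;> linarith [(hI l).1, (hI l).2, (h01 l x).1, (h01 l x).2]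
  have hm : ∀ l, Measurable fun x => f l x - ∫ y, f l y ∂μ := fun l => (hf l).sub_const _
  have hG : ∀ l, MemLp (fun x => f l x - ∫ y, f l y ∂μ) 2 μ := fun l =>
    MemLp.of_bound (hm l).aestronglyMeasurable 1 (Eventually.of_forall (hb l))
  let U : Lp ℝ 2 μ →L[ℝ] Lp ℝ 2 μ :=
    (Lp.compMeasurePreservingₗᵢ ℝ T hT.toMeasurePreserving).toContinuousLinearMap
  have hUae : ∀ v : Lp ℝ 2 μ, U v =ᵐ[μ] v ∘ T := fun v =>
    Lp.coeFn_compMeasurePreserving v hT.toMeasurePreserving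
  have key := tendsto_inner_of_asymptotically_fixed U (fun l => (hG l).toLp _) 1 ?_ ?_ ?_
    (indicatorConstLp 2 hs (measure_ne_top μ s) (1 : ℝ))
  · refine key.congr fun l => ?_
    rw [L2.inner_indicatorConstLp_one]
    exact setIntegral_congr_ae hs ((hG l).coeFn_toLp.mono fun x hx _ => hx)
  · intro l
    refine (Lp.norm_le_of_ae_bound zero_le_one
      ((hG l).coeFn_toLp.mono fun x hx => by rw [hx]; exact hb l x)).trans ?_
    simp [measureUnivNNReal]
  -- The increments are bounded by one, so their squares are dominated by their absolute values and
  -- `L¹` invariance yields `L²` invariance.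
  · have hsq : Tendsto (fun l => ‖U ((hG l).toLp _) - (hG l).toLp _‖ ^ 2) atTop (𝓝 0) := by
      refine squeeze_zero (fun l => sq_nonneg _) (fun l => ?_) hinv
      rw [← real_inner_self_eq_norm_sq, L2.inner_def]
      have hae : (fun x => inner ℝ ((U ((hG l).toLp _) - (hG l).toLp _ : Lp ℝ 2 μ) x)
          ((U ((hG l).toLp _) - (hG l).toLp _ : Lp ℝ 2 μ) x)) =ᵐ[μ]
          fun x => (f l (T x) - f l x) ^ 2 := by
        filter_upwards [Lp.coeFn_sub (U ((hG l).toLp _)) ((hG l).toLp _), hUae ((hG l).toLp _),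
          (hG l).coeFn_toLp, hT.quasiMeasurePreserving.ae (hG l).coeFn_toLp] with x h1 h2 h3 h4
        rw [h1, Pi.sub_apply, h2, h3, Function.comp_apply, h4, real_inner_self_eq_norm_sq,
          Real.norm_eq_abs, sq_abs]
        ring
      rw [integral_congr_ae hae]
      have hd : ∀ x, |f l (T x) - f l x| ≤ 1 := fun x => by
        rw [abs_le]
        constructor <;> linarith [(h01 l x).1, (h01 l x).2, (h01 l (T x)).1, (h01 l (T x)).2]
      have hmd : Measurable fun x => f l (T x) - f l x := ((hf l).comp hT.measurable).sub (hf l)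
      refine integral_mono_of_nonneg (Eventually.of_forall fun x => sq_nonneg _)
        (Integrable.of_bound hmd.abs.aestronglyMeasurable 1 (Eventually.of_forall fun x => ?_))
        (Eventually.of_forall fun x => ?_)
      · simpa using hd x
      · change (f l (T x) - f l x) ^ 2 ≤ |f l (T x) - f l x|
        rw [← sq_abs]
        nlinarith [abs_nonneg (f l (T x) - f l x), hd x]
    have h2 := hsq.sqrt
    simpa [Real.sqrt_sq (norm_nonneg _)] using h2
  · intro v hv
    have h1 : v ∘ T =ᵐ[μ] v := by
      have := hUae v
      rw [hv] at this
      exact this.symm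
    obtain ⟨c, hc⟩ := hT.ae_eq_const_of_ae_eq_comp_ae (Lp.aestronglyMeasurable v) h1
    have h2 : ∀ l, inner ℝ v ((hG l).toLp _) = 0 := by
      intro l
      rw [L2.inner_def]
      have hae : (fun x => inner ℝ (v x) ((hG l).toLp _ x)) =ᵐ[μ]
          fun x => c * (f l x - ∫ y, f l y ∂μ) := by
        filter_upwards [hc, (hG l).coeFn_toLp] with x h1 h2
        rw [h1, h2]
        simp [mul_comm]
      rw [integral_congr_ae hae, integral_const_mul,
        integral_sub (integrable_of_mem_Icc (hf l) (h01 l)) (integrable_const _)]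
      simp
    simp [h2]

/-- Integrals of uniformly bounded, asymptotically invariant functions against an integrable
weight are asymptotically determined by the total weight. -/
lemma tendsto_integral_mul_of_asymptotically_invariant (hT : Ergodic T μ) {f : ℕ → X → ℝ}
    (hf : ∀ l, Measurable (f l)) (h01 : ∀ l x, f l x ∈ Set.Icc (0 : ℝ) 1)
    (hinv : Tendsto (fun l => ∫ x, |f l (T x) - f l x| ∂μ) atTop (𝓝 0))
    {g : X → ℝ} (hg : Integrable g μ) :
    Tendsto (fun l => ∫ x, g x * (f l x - ∫ y, f l y ∂μ) ∂μ) atTop (𝓝 0) := by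
  have hI : ∀ l, ∫ y, f l y ∂μ ∈ Set.Icc (0 : ℝ) 1 := fun l => integral_mem_Icc (hf l) (h01 l)
  have hb : ∀ l x, ‖f l x - ∫ y, f l y ∂μ‖ ≤ 1 := fun l x => by
    rw [Real.norm_eq_abs, abs_le]
    constructor <;> linarith [(hI l).1, (hI l).2, (h01 l x).1, (h01 l x).2]
  have hm : ∀ l, Measurable fun x => f l x - ∫ y, f l y ∂μ := fun l => (hf l).sub_const _
  have hint : ∀ {g : X → ℝ} (l : ℕ), Integrable g μ →
      Integrable (fun x => g x * (f l x - ∫ y, f l y ∂μ)) μ := fun l hg =>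
    hg.mul_bdd (c := 1) (hm l).aestronglyMeasurable (Eventually.of_forall (hb l))
  -- The property holds for indicators and sums, and it is closed in `L¹` because the centred
  -- functions are bounded by one.
  refine hg.induction (P := fun g =>
    Tendsto (fun l => ∫ x, g x * (f l x - ∫ y, f l y ∂μ) ∂μ) atTop (𝓝 0)) ?_ ?_ ?_ ?_
  · intro c s hs _
    have h1 := (tendsto_setIntegral_of_asymptotically_invariant hT hf h01 hinv hs).const_mul c
    rw [mul_zero] at h1
    refine h1.congr fun l => ?_
    rw [← integral_const_mul, ← integral_indicator hs]
    congr 1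
    ext x
    by_cases hx : x ∈ s <;> simp [hx]
  · intro g g' _ hg hg' h h'
    have h1 := h.add h'
    rw [add_zero] at h1
    refine h1.congr fun l => ?_
    rw [← integral_add (hint l hg) (hint l hg')]
    simp [add_mul]
  · refine isClosed_of_closure_subset fun v hv => ?_
    change Tendsto (fun l => ∫ x, v x * (f l x - ∫ y, f l y ∂μ) ∂μ) atTop (𝓝 0)
    rw [Metric.tendsto_atTop]
    intro ε hε
    obtain ⟨w, hw, hvw⟩ := Metric.mem_closure_iff.1 hv (ε / 2) (by positivity)
    obtain ⟨N, hN⟩ := Metric.tendsto_atTop.1 hw (ε / 2) (by positivity)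
    refine ⟨N, fun l hl => ?_⟩
    have h1 := hN l hl
    rw [Real.dist_eq, sub_zero] at h1 ⊢
    have hvi := L1.integrable_coeFn v
    have hwi := L1.integrable_coeFn w
    have h2 : |∫ x, v x * (f l x - ∫ y, f l y ∂μ) ∂μ - ∫ x, w x * (f l x - ∫ y, f l y ∂μ) ∂μ|
        ≤ dist v w := by
      rw [← integral_sub (hint l hvi) (hint l hwi), L1.dist_eq_integral_dist]
      simp only [Real.dist_eq]
      refine (abs_integral_le_integral_abs).trans
        (integral_mono ((hint l hvi).sub (hint l hwi)).abs (hvi.sub hwi).norm fun x => ?_)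
      rw [← sub_mul, abs_mul]
      exact mul_le_of_le_one_right (abs_nonneg _) (hb l x)
    rw [abs_lt] at h1 ⊢
    rw [abs_le] at h2
    constructor <;> linarith
  · intro g g' hgg' _ h
    refine h.congr fun l => integral_congr_ae (hgg'.mono fun x hx => ?_)
    simp only [hx]

/-- Take the density of `κ` as the integrable weight. -/
lemma tendsto_integral_sub_of_absolutelyContinuous (hT : Ergodic T μ) {f : ℕ → X → ℝ}
    (hf : ∀ l, Measurable (f l)) (h01 : ∀ l x, f l x ∈ Set.Icc (0 : ℝ) 1)
    (hinv : Tendsto (fun l => ∫ x, |f l (T x) - f l x| ∂μ) atTop (𝓝 0))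
    (κ : AbsContProb μ) :
    Tendsto (fun l => ∫ x, f l x ∂κ.toMeasure - ∫ x, f l x ∂μ) atTop (𝓝 0) := by
  have hac : κ.toMeasure ≪ μ := κ.2.2
  refine (tendsto_integral_mul_of_asymptotically_invariant hT hf h01 hinv
    (Measure.integrable_toReal_rnDeriv (μ := κ.toMeasure) (ν := μ))).congr fun l => ?_
  have h1 := integral_rnDeriv_smul hac (f := fun x => f l x - ∫ y, f l y ∂μ)
  simp only [smul_eq_mul] at h1
  rw [h1, integral_sub (integrable_of_mem_Icc (hf l) (h01 l)) (integrable_const _)]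
  simp

/-- Integration against a `[0,1]`-valued function is `1/2`-Lipschitz in total variation, uniformly
in `l`. Convergence at the finitely many centres of an `ε`-net therefore extends to the whole
compact set. -/
lemma eventually_forall_mem_compact_abs_integral_sub_le (hT : Ergodic T μ) {f : ℕ → X → ℝ}
    (hf : ∀ l, Measurable (f l)) (h01 : ∀ l x, f l x ∈ Set.Icc (0 : ℝ) 1)
    (hinv : Tendsto (fun l => ∫ x, |f l (T x) - f l x| ∂μ) atTop (𝓝 0))
    {𝔎 : Set (AbsContProb μ)} (h𝔎 : IsCompact 𝔎) {ε : ℝ} (hε : 0 < ε) :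
    ∀ᶠ l in atTop, ∀ κ ∈ 𝔎, |∫ x, f l x ∂κ.toMeasure - ∫ x, f l x ∂μ| ≤ ε := by
  obtain ⟨t, -, htfin, hcov⟩ := h𝔎.finite_cover_balls hε
  have hev : ∀ᶠ l in atTop, ∀ κ ∈ t, |∫ x, f l x ∂κ.toMeasure - ∫ x, f l x ∂μ| ≤ ε / 2 := by
    rw [htfin.eventually_all]
    intro κ _
    have h1 := Metric.tendsto_nhds.1
      (tendsto_integral_sub_of_absolutelyContinuous hT hf h01 hinv κ) (ε / 2) (by positivity)
    filter_upwards [h1] with l hl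
    rw [Real.dist_eq, sub_zero] at hl
    exact hl.le
  filter_upwards [hev] with l hl κ hκ
  obtain ⟨κ', hκ', hd⟩ := Set.mem_iUnion₂.1 (hcov hκ)
  have h1 : tvDist κ.toMeasure κ'.toMeasure < ε := hd
  have h2 := abs_integral_sub_le_tvDist κ.toMeasure κ'.toMeasure (hf l) (h01 l)
  have h3 := hl κ' hκ'
  rw [abs_le] at h2 h3 ⊢
  constructor <;> linarith

end AsymptoticInvariance

/-! ### First hitting times and entrance maps along an orbit. -/

section HittingTimes

variable {X : Type*} {T : X → X} {A : Set X} {x : X}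

lemma hitTime_le {n : ℕ} (hn : 1 ≤ n) (hx : T^[n] x ∈ A) : hitTime T A x ≤ n :=
  iInf₂_le n ⟨hn, hx⟩

lemma le_hitTime_iff {c : ℕ∞} : c ≤ hitTime T A x ↔ ∀ n : ℕ, 1 ≤ n → T^[n] x ∈ A → c ≤ n := by
  simp only [hitTime, le_iInf_iff, and_imp]

lemma natCast_lt_hitTime_iff {n : ℕ} :
    (n : ℕ∞) < hitTime T A x ↔ ∀ m, 1 ≤ m → m ≤ n → T^[m] x ∉ A := by
  constructor
  · intro h m h1 hmn hm
    exact absurd ((hitTime_le h1 hm).trans (Nat.cast_le.2 hmn)) (not_le.2 h)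
  · intro h
    have h1 : ((n + 1 : ℕ) : ℕ∞) ≤ hitTime T A x := le_hitTime_iff.2 fun m h1 hm => by
      by_contra hlt
      exact h m h1 (Nat.lt_succ_iff.1 (Nat.cast_lt.1 (not_le.1 hlt))) hm
    exact (Nat.cast_lt.2 (Nat.lt_succ_self n)).trans_le h1

lemma hitTime_eq_top_iff : hitTime T A x = ⊤ ↔ ∀ n, 1 ≤ n → T^[n] x ∉ A := by
  rw [← top_le_iff, le_hitTime_iff]
  refine forall₂_congr fun n _ => ?_
  simp

lemma hitTime_spec {m : ℕ} (h : hitTime T A x = m) : 1 ≤ m ∧ T^[m] x ∈ A := by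
  have h1 : ¬ ((m : ℕ∞) < hitTime T A x) := by simp [h]
  rw [natCast_lt_hitTime_iff] at h1
  push Not at h1
  obtain ⟨n, hn1, hnm, hn⟩ := h1
  have h2 : m ≤ n := by
    have := hitTime_le hn1 hn
    rw [h] at this
    exact Nat.cast_le.1 this
  obtain rfl : n = m := le_antisymm hnm h2
  exact ⟨hn1, hn⟩

/-- Before the first hit, waiting `j` steps only subtracts `j` from the remaining time. The addition
in `ℕ∞` covers orbits that never hit. -/
lemma hitTime_eq_add {j : ℕ} (hj : (j : ℕ∞) < hitTime T A x) :
    hitTime T A x = j + hitTime T A (T^[j] x) := by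
  have hno := natCast_lt_hitTime_iff.1 hj
  apply le_antisymm
  · generalize hm : hitTime T A (T^[j] x) = c
    induction c with
    | top => simp
    | coe m =>
      obtain ⟨h1, h2⟩ := hitTime_spec hm
      rw [← Function.iterate_add_apply] at h2
      exact (hitTime_le (by omega) h2).trans (by simp [add_comm])
  · refine le_hitTime_iff.2 fun n hn hx => ?_
    have hlt : j < n := by
      by_contra hle
      exact hno n hn (not_lt.1 hle) hx
    obtain ⟨i, rfl⟩ := Nat.exists_eq_add_of_lt hlt
    have h1 : T^[i + 1] (T^[j] x) ∈ A := by
      rw [← Function.iterate_add_apply]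
      convert hx using 2
      ring
    calc (j : ℕ∞) + hitTime T A (T^[j] x) ≤ j + ((i + 1 : ℕ) : ℕ∞) := by
          gcongr
          exact hitTime_le (by omega) h1
      _ = ((j + i + 1 : ℕ) : ℕ∞) := by push_cast; ring

lemma hitTime_eq_one (hx : T x ∈ A) : hitTime T A x = 1 :=
  le_antisymm (by simpa using hitTime_le (n := 1) le_rfl hx)
    (le_hitTime_iff.2 fun n hn _ => by exact_mod_cast hn)

lemma one_lt_hitTime (hx : T x ∉ A) : ((1 : ℕ) : ℕ∞) < hitTime T A x :=
  natCast_lt_hitTime_iff.2 fun m h1 h2 => by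
    obtain rfl : m = 1 := le_antisymm h2 h1
    exact hx

lemma entranceMap_eq_of_hitTime_eq {m : ℕ} (h : hitTime T A x = m) :
    entranceMap T A x = T^[m] x := by
  simp [entranceMap, inducedMap, h]

lemma entranceMap_iterate {j : ℕ} (hj : (j : ℕ∞) < hitTime T A x) (hfin : hitTime T A x ≠ ⊤) :
    entranceMap T A (T^[j] x) = entranceMap T A x := by
  have h := hitTime_eq_add hj
  generalize hm : hitTime T A (T^[j] x) = c at h
  induction c with
  | top => simp [h] at hfin
  | coe m =>
    have h' : hitTime T A x = ((m + j : ℕ) : ℕ∞) := by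
      rw [h, Nat.cast_add, add_comm]
    rw [entranceMap_eq_of_hitTime_eq hm, entranceMap_eq_of_hitTime_eq h',
      Function.iterate_add_apply]

end HittingTimes

/-! ### Measurability, and almost sure finiteness of hitting times. -/

section Measurability

variable {X : Type*} [MeasurableSpace X] {T : X → X} {A : Set X}

lemma measurable_hitTime (hT : Measurable T) (hA : MeasurableSet A) :
    Measurable (hitTime T A) := by
  have hlt : ∀ n : ℕ, MeasurableSet {x | (n : ℕ∞) < hitTime T A x} := fun n => by
    simp only [natCast_lt_hitTime_iff]
    have : {x | ∀ m, 1 ≤ m → m ≤ n → T^[m] x ∉ A} =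
        ⋂ (m : ℕ) (_ : 1 ≤ m) (_ : m ≤ n), (T^[m] ⁻¹' A)ᶜ := by
      ext x
      simp
    rw [this]
    exact MeasurableSet.iInter fun m => MeasurableSet.iInter fun _ => MeasurableSet.iInter fun _ =>
      ((hT.iterate m) hA).compl
  rw [ENat.measurable_iff]
  intro n
  have : hitTime T A ⁻¹' {(n : ℕ∞)} =
      (⋂ (m : ℕ) (_ : m < n), {x | (m : ℕ∞) < hitTime T A x}) \ {x | (n : ℕ∞) < hitTime T A x} := by
    ext x
    simp only [Set.mem_preimage, Set.mem_singleton_iff, Set.mem_sdiff, Set.mem_iInter,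
      Set.mem_ofPred_eq, not_lt]
    constructor
    · intro h
      exact ⟨fun m hm => by rw [h]; exact_mod_cast hm, h.le⟩
    · rintro ⟨h1, h2⟩
      obtain ⟨m, hm⟩ := ENat.ne_top_iff_exists.1 (ne_top_of_le_ne_top (ENat.natCast_ne_top n) h2)
      rw [← hm] at h2 ⊢
      refine congrArg _ (le_antisymm (Nat.cast_le.1 h2) ?_)
      by_contra hlt
      have := h1 m (not_le.1 hlt)
      rw [← hm] at this
      exact lt_irrefl _ this
  rw [this]
  exact (MeasurableSet.iInter fun m => MeasurableSet.iInter fun _ => hlt m).diff (hlt n)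

lemma measurable_inducedMap (hT : Measurable T) {τ : X → ℕ} (hτ : Measurable τ) :
    Measurable (inducedMap T τ) := by
  have h : Measurable fun p : X × ℕ => T^[p.2] p.1 :=
    measurable_from_prod_countable_left fun n => hT.iterate n
  exact h.comp (measurable_id.prodMk hτ)

lemma measurable_entranceMap (hT : Measurable T) (hA : MeasurableSet A) :
    Measurable (entranceMap T A) :=
  measurable_inducedMap hT ((measurable_from_top (f := ENat.toNat)).comp (measurable_hitTime hT hA))

lemma measurable_hitProcess (hT : Measurable T) (hA : MeasurableSet A) :
    Measurable (hitProcess T A) :=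
  measurable_pi_lambda _ fun j => (measurable_from_top (f := fun n : ℕ∞ => (n : ℝ≥0∞))).comp
    ((measurable_hitTime hT hA).comp ((measurable_entranceMap hT hA).iterate j))

lemma measurable_scaledHitProcess (μ : Measure X) (hT : Measurable T) (hA : MeasurableSet A) :
    Measurable (scaledHitProcess μ T A) :=
  measurable_pi_lambda _ fun j =>
    ((measurable_pi_apply j).comp (measurable_hitProcess hT hA)).const_mul _

/-- The set of finite hitting times contains its own preimage, so ergodicity makes it null or
conull. It contains `T⁻¹ A`, of measure `μ A > 0`, so it is not null. -/
lemma ae_hitTime_ne_top {μ : Measure X} [IsProbabilityMeasure μ] (hT : Ergodic T μ)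
    (hA : MeasurableSet A) (hpos : μ A ≠ 0) : ∀ᵐ x ∂μ, hitTime T A x ≠ ⊤ := by
  have hmeas : MeasurableSet {x | hitTime T A x ≠ ⊤} :=
    (measurable_hitTime hT.measurable hA) (MeasurableSet.of_discrete (s := {⊤}ᶜ))
  have hsub : T ⁻¹' {x | hitTime T A x ≠ ⊤} ⊆ {x | hitTime T A x ≠ ⊤} := by
    intro x hx htop
    rw [hitTime_eq_top_iff] at htop
    refine hx (hitTime_eq_top_iff.2 fun n _ => ?_)
    rw [← Function.iterate_succ_apply]
    exact htop (n + 1) (by omega)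
  rcases hT.ae_empty_or_univ_of_preimage_ae_le hmeas.nullMeasurableSet
    (LE.le.eventuallyLE hsub) with h | h
  · exfalso
    have h0 : μ {x | hitTime T A x ≠ ⊤} = 0 := by rw [measure_congr h, measure_empty]
    have h1 : μ (T ⁻¹' A) = 0 := measure_mono_null (fun x hx => by
      change hitTime T A x ≠ ⊤
      rw [hitTime_eq_one (A := A) hx]
      exact ENat.natCast_ne_top 1) h0
    rw [hT.measure_preimage hA.nullMeasurableSet] at h1
    exact hpos h1
  · exact (eventuallyEq_univ.1 h)

end Measurability

/-! ### The function `H` carrying the recursion over coordinates. -/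

section EntranceTransform

variable {X : Type*} [MeasurableSpace X] {μ : Measure X} {T : X → X} {A : Set X}

/-- The function `x ↦ e^{-k μ(A) φ_A(x)} W(T_A x)`. -/
def entranceTransform (μ : Measure X) (T : X → X) (A : Set X) (k : ℕ) (W : X → ℝ) (x : X) : ℝ :=
  expNeg (μ A * ((hitTime T A x : ℕ∞) : ℝ≥0∞)) ^ k * W (entranceMap T A x)

lemma measurable_entranceTransform (hT : Measurable T) (hA : MeasurableSet A) (k : ℕ) {W : X → ℝ}
    (hW : Measurable W) : Measurable (entranceTransform μ T A k W) :=
  ((measurable_expNeg.comp (((measurable_from_top (f := fun n : ℕ∞ => (n : ℝ≥0∞))).comp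
    (measurable_hitTime hT hA)).const_mul _)).pow_const k).mul
    (hW.comp (measurable_entranceMap hT hA))

lemma mul_mem_unitInterval {a b : ℝ} (ha : a ∈ Set.Icc (0 : ℝ) 1) (hb : b ∈ Set.Icc (0 : ℝ) 1) :
    a * b ∈ Set.Icc (0 : ℝ) 1 :=
  ⟨mul_nonneg ha.1 hb.1, mul_le_one₀ ha.2 hb.1 hb.2⟩

lemma entranceTransform_mem_Icc {k : ℕ} {W : X → ℝ} (h01 : ∀ x, W x ∈ Set.Icc (0 : ℝ) 1) (x : X) :
    entranceTransform μ T A k W x ∈ Set.Icc (0 : ℝ) 1 :=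
  mul_mem_unitInterval (expNeg_pow_mem _ k) (h01 _)

/-- Finiteness matters when `k = 0`: the exponential factor is then one even at infinite hitting
times, where `entranceMap` defaults to the identity and is not constant along the orbit. -/
lemma entranceTransform_eq_mul_iterate {k : ℕ} {W : X → ℝ} {x : X} {j : ℕ}
    (hj : (j : ℕ∞) < hitTime T A x) (hfin : hitTime T A x ≠ ⊤) :
    entranceTransform μ T A k W x = expNeg (μ A * j) ^ k * entranceTransform μ T A k W (T^[j] x) := by
  rw [entranceTransform, entranceTransform, entranceMap_iterate hj hfin, hitTime_eq_add hj,
    ENat.toENNReal_add, mul_add, expNeg_add, mul_pow, mul_assoc]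
  rfl

lemma entranceTransform_of_mem {k : ℕ} {W : X → ℝ} {x : X} (hx : T x ∈ A) :
    entranceTransform μ T A k W x = expNeg (μ A) ^ k * W (T x) := by
  have h : hitTime T A x = ((1 : ℕ) : ℕ∞) := by simpa using hitTime_eq_one hx
  rw [entranceTransform, entranceMap_eq_of_hitTime_eq h, h]
  simp

lemma scaledHitProcess_succ (A : Set X) (x : X) (j : ℕ) :
    scaledHitProcess μ T A x (j + 1) = scaledHitProcess μ T A (entranceMap T A x) j := by
  simp only [scaledHitProcess, hitProcess, Function.iterate_succ_apply]

lemma expMonomial_succ_scaledHitProcess (A : Set X) (d : ℕ) (k : ℕ → ℕ) (x : X) :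
    expMonomial (d + 1) k (scaledHitProcess μ T A x) =
      entranceTransform μ T A (k 0)
        (fun y => expMonomial d (fun j => k (j + 1)) (scaledHitProcess μ T A y)) x := by
  rw [expMonomial, Finset.prod_range_succ', mul_comm]
  simp only [scaledHitProcess_succ]
  rfl

variable [IsFiniteMeasure μ]

lemma one_sub_expNeg_mul_natCast_pow_le (A : Set X) (j k : ℕ) :
    1 - expNeg (μ A * j) ^ k ≤ k * (μ.real A * j) := by
  refine one_sub_expNeg_pow_le (by positivity) ?_ k
  rw [ENNReal.ofReal_mul measureReal_nonneg, ofReal_measureReal, ENNReal.ofReal_natCast]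

/-- Used with `j = 1` for asymptotic invariance and with `j = τ` on the escaping part. -/
lemma abs_entranceTransform_sub_iterate_le {k : ℕ} {W : X → ℝ}
    (h01 : ∀ x, W x ∈ Set.Icc (0 : ℝ) 1) {x : X} {j : ℕ}
    (hj : (j : ℕ∞) < hitTime T A x) (hfin : hitTime T A x ≠ ⊤) :
    |entranceTransform μ T A k W x - entranceTransform μ T A k W (T^[j] x)|
      ≤ k * (μ.real A * j) := by
  rw [entranceTransform_eq_mul_iterate hj hfin]
  have h1 := entranceTransform_mem_Icc (μ := μ) (T := T) (A := A) (k := k) h01 (T^[j] x)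
  have h2 := expNeg_pow_mem (μ A * j) k
  have h3 := one_sub_expNeg_mul_natCast_pow_le (μ := μ) A j k
  rw [abs_le]
  constructor <;> nlinarith [h1.1, h1.2, h2.1, h2.2]

/-- The counterpart for the returning part: an entrance by time `j` leaves the exponential factor
near one. -/
lemma abs_entranceTransform_sub_entranceMap_le {k : ℕ} {W : X → ℝ}
    (h01 : ∀ x, W x ∈ Set.Icc (0 : ℝ) 1) {x : X} {j : ℕ} (hj : hitTime T A x ≤ j) :
    |entranceTransform μ T A k W x - W (entranceMap T A x)| ≤ k * (μ.real A * j) := by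
  rw [entranceTransform]
  have h1 := h01 (entranceMap T A x)
  have h2 := expNeg_pow_mem (μ A * ((hitTime T A x : ℕ∞) : ℝ≥0∞)) k
  have h3 : 1 - expNeg (μ A * ((hitTime T A x : ℕ∞) : ℝ≥0∞)) ^ k ≤ k * (μ.real A * j) := by
    refine one_sub_expNeg_pow_le (by positivity) ?_ k
    rw [ENNReal.ofReal_mul measureReal_nonneg, ofReal_measureReal, ENNReal.ofReal_natCast]
    gcongr
    exact_mod_cast ENat.toENNReal_le.2 hj
  rw [abs_le]
  constructor <;> nlinarith [h1.1, h1.2, h2.1, h2.2]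

end EntranceTransform

/-! ### Comparing starts from `μ` and from `μ_A`. -/

section KacIdentity

variable {X : Type*} [MeasurableSpace X] {μ : Measure X} [IsProbabilityMeasure μ] {T : X → X}
  {A : Set X}

lemma integral_cond_mul_measureReal (hpos : μ A ≠ 0) (f : X → ℝ) :
    μ.real A * ∫ x, f x ∂μ[|A] = ∫ x in A, f x ∂μ := by
  rw [ProbabilityTheory.cond, integral_smul_measure, ENNReal.toReal_inv, smul_eq_mul, ← mul_assoc]
  change μ.real A * (μ.real A)⁻¹ * _ = _
  rw [mul_inv_cancel₀, one_mul]
  exact (measureReal_ne_zero_iff (measure_ne_top μ A)).2 hpos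

/-- The exact relation between the Laplace transforms of hitting and return processes. -/
lemma exp_sub_one_mul_integral_entranceTransform (hT : Ergodic T μ) (hA : MeasurableSet A)
    (hpos : μ A ≠ 0) (k : ℕ) {W : X → ℝ} (hW : Measurable W)
    (h01 : ∀ x, W x ∈ Set.Icc (0 : ℝ) 1) :
    (Real.exp (k * μ.real A) - 1) * ∫ x, entranceTransform μ T A k W x ∂μ =
      μ.real A * (∫ x, W x ∂μ[|A] - ∫ x, entranceTransform μ T A k W x ∂μ[|A]) := by
  set H := entranceTransform μ T A k W with hH
  have hHm : Measurable H := measurable_entranceTransform hT.measurable hA k hW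
  have hHi : Integrable H μ := integrable_of_mem_Icc hHm (entranceTransform_mem_Icc h01)
  have hWi : Integrable W μ := integrable_of_mem_Icc hW h01
  -- After one step the orbit is either in `A`, where `W` is evaluated, or still outside, where `H`
  -- restarts; both cases cost one factor `e^{-kμ(A)}`. Integrating and using invariance of `μ`
  -- gives the identity.
  have hpt : ∀ᵐ x ∂μ, H x = expNeg (μ A) ^ k * (A.indicator W + Aᶜ.indicator H) (T x) := by
    filter_upwards [ae_hitTime_ne_top hT hA hpos] with x hx
    by_cases hTx : T x ∈ A
    · simp [hH, entranceTransform_of_mem hTx, hTx]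
    · have h1 := entranceTransform_eq_mul_iterate (μ := μ) (k := k) (W := W) (one_lt_hitTime hTx) hx
      simpa [hTx] using h1
  have hm : AEStronglyMeasurable (A.indicator W + Aᶜ.indicator H) (μ.map T) :=
    ((hW.indicator hA).add (hHm.indicator hA.compl)).aestronglyMeasurable
  have hint : ∫ x, H x ∂μ = expNeg (μ A) ^ k * (∫ x in A, W x ∂μ + ∫ x in Aᶜ, H x ∂μ) := by
    rw [integral_congr_ae hpt, integral_const_mul, ← integral_map hT.measurable.aemeasurable hm,
      hT.map_eq]
    simp only [Pi.add_apply]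
    rw [integral_add (hWi.indicator hA) (hHi.indicator hA.compl), integral_indicator hA,
      integral_indicator hA.compl]
  have hsplit := integral_add_compl hA hHi
  have hexp : expNeg (μ A) ^ k = Real.exp (-(k * μ.real A)) := by
    rw [expNeg_of_ne_top (measure_ne_top μ A), ← Real.exp_nat_mul, mul_neg]
    rfl
  rw [mul_sub, integral_cond_mul_measureReal hpos, integral_cond_mul_measureReal hpos]
  have hmul : Real.exp (k * μ.real A) * Real.exp (-(k * μ.real A)) = 1 := by
    rw [← Real.exp_add]
    simp
  rw [hexp] at hint
  have h2 : Real.exp (k * μ.real A) * ∫ x, H x ∂μ = ∫ x in A, W x ∂μ + ∫ x in Aᶜ, H x ∂μ := by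
    rw [hint, ← mul_assoc, hmul, one_mul]
  linarith

/-- On `T⁻¹ A`, which has measure `μ(A)`, the increment is at most one; elsewhere a single step
changes `H` by at most `k μ(A)`. -/
lemma integral_abs_entranceTransform_comp_sub_le (hT : Ergodic T μ) (hA : MeasurableSet A)
    (hpos : μ A ≠ 0) (k : ℕ) {W : X → ℝ} (hW : Measurable W)
    (h01 : ∀ x, W x ∈ Set.Icc (0 : ℝ) 1) :
    ∫ x, |entranceTransform μ T A k W (T x) - entranceTransform μ T A k W x| ∂μ ≤
      (k + 1) * μ.real A := by
  set H := entranceTransform μ T A k W with hH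
  have hHm : Measurable H := measurable_entranceTransform hT.measurable hA k hW
  have hH01 : ∀ x, H x ∈ Set.Icc (0 : ℝ) 1 := entranceTransform_mem_Icc h01
  have hTA : MeasurableSet (T ⁻¹' A) := hT.measurable hA
  have hle : ∀ᵐ x ∂μ, |H (T x) - H x| ≤ (T ⁻¹' A).indicator (fun _ => (1 : ℝ)) x + k * μ.real A := by
    filter_upwards [ae_hitTime_ne_top hT hA hpos] with x hx
    have hk : 0 ≤ k * μ.real A := by positivity
    by_cases hTx : T x ∈ A
    · rw [Set.indicator_of_mem (by exact hTx), abs_le]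
      constructor <;> linarith [(hH01 x).1, (hH01 x).2, (hH01 (T x)).1, (hH01 (T x)).2]
    · have h1 := abs_entranceTransform_sub_iterate_le (μ := μ) (k := k) h01 (one_lt_hitTime hTx) hx
      rw [Set.indicator_of_notMem (by exact hTx), abs_sub_comm]
      simpa using h1
  have hi : Integrable (fun x => (T ⁻¹' A).indicator (fun _ => (1 : ℝ)) x) μ :=
    (integrable_const (1 : ℝ)).indicator hTA
  have h1 := integral_mono_of_nonneg (Eventually.of_forall fun x => abs_nonneg (H (T x) - H x))
    (hi.add (integrable_const (k * μ.real A))) hle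
  refine h1.trans (le_of_eq ?_)
  simp only [Pi.add_apply]
  rw [integral_add hi (integrable_const _), integral_indicator hTA]
  simp only [integral_const, smul_eq_mul, mul_one, measureReal_restrict_apply_univ, probReal_univ]
  rw [measureReal_def, hT.measure_preimage hA.nullMeasurableSet, ← measureReal_def]
  ring

end KacIdentity

/-! ### Returning and escaping parts, and the limit of the transforms. -/

section Splitting

variable {X : Type*} [MeasurableSpace X]

/-- Outside `G` and where `t ≥ δ` the trivial bound one is used; on the remaining set the difference
is at most `k δ`. -/
lemma abs_integral_sub_le_of_ae_close {ρ : Measure X} [IsProbabilityMeasure ρ] {f g : X → ℝ}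
    (hf : Measurable f) (hg : Measurable g) (hf01 : ∀ x, f x ∈ Set.Icc (0 : ℝ) 1)
    (hg01 : ∀ x, g x ∈ Set.Icc (0 : ℝ) 1) {t : X → ℝ} (ht : Measurable t) {k δ : ℝ} (hk : 0 ≤ k)
    (hδ : 0 ≤ δ) {G : Set X} (hG : MeasurableSet G)
    (hclose : ∀ᵐ x ∂ρ, x ∈ G → |f x - g x| ≤ k * t x) :
    |∫ x, f x ∂ρ - ∫ x, g x ∂ρ| ≤ (1 - ρ.real G) + ρ.real {x | δ ≤ t x} + k * δ := by
  have hS : MeasurableSet {x | δ ≤ t x} := measurableSet_le measurable_const ht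
  have hle : ∀ᵐ x ∂ρ, |f x - g x| ≤
      Gᶜ.indicator (fun _ => (1 : ℝ)) x + {x | δ ≤ t x}.indicator (fun _ => (1 : ℝ)) x + k * δ := by
    filter_upwards [hclose] with x hx
    have h1 : |f x - g x| ≤ 1 := by
      rw [abs_le]
      constructor <;> linarith [(hf01 x).1, (hf01 x).2, (hg01 x).1, (hg01 x).2]
    have h2 : 0 ≤ Gᶜ.indicator (fun _ => (1 : ℝ)) x :=
      Set.indicator_nonneg (fun _ _ => zero_le_one) x
    have h3 : 0 ≤ {x | δ ≤ t x}.indicator (fun _ => (1 : ℝ)) x :=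
      Set.indicator_nonneg (fun _ _ => zero_le_one) x
    have h4 : 0 ≤ k * δ := mul_nonneg hk hδ
    by_cases hxG : x ∈ G
    · by_cases hxS : δ ≤ t x
      · rw [Set.indicator_of_mem (s := {x | δ ≤ t x}) hxS]
        linarith
      · have h5 : k * t x ≤ k * δ := mul_le_mul_of_nonneg_left (not_le.1 hxS).le hk
        linarith [hx hxG]
    · rw [Set.indicator_of_mem (s := Gᶜ) hxG]
      linarith
  have hi : ∀ {s : Set X}, MeasurableSet s →
      Integrable (fun x => s.indicator (fun _ => (1 : ℝ)) x) ρ := fun hs =>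
    (integrable_const (1 : ℝ)).indicator hs
  rw [← integral_sub (integrable_of_mem_Icc hf hf01) (integrable_of_mem_Icc hg hg01)]
  refine abs_integral_le_integral_abs.trans ?_
  refine (integral_mono_of_nonneg (Eventually.of_forall fun x => abs_nonneg _)
    (((hi hG.compl).add (hi hS)).add (integrable_const (k * δ))) hle).trans (le_of_eq ?_)
  have hadd := integral_add ((hi hG.compl).add (hi hS)) (integrable_const (k * δ))
  simp only [Pi.add_apply] at hadd ⊢
  rw [hadd, integral_add (hi hG.compl) (hi hS), integral_indicator hG.compl, integral_indicator hS]
  simp [probReal_compl_eq_one_sub hG]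

lemma measureReal_mul_cond_le {ν : Measure X} [IsProbabilityMeasure ν] {B : Set X}
    (hB : MeasurableSet B) (s : Set X) : ν.real B * (ν[|B]).real s ≤ ν.real s := by
  rw [mul_comm, measureReal_def, measureReal_def, ← ENNReal.toReal_mul, cond_mul_eq_inter hB]
  exact measureReal_mono Set.inter_subset_right

/-- Negligibility of the delay is known under `ν`, not under `ν[|B]`. Working with unnormalized
integrals over `B` absorbs the factor `ν(B)`, so no lower bound on `ν(B)` is required. -/
lemma measureReal_mul_abs_integral_sub_le {ν : Measure X} [IsProbabilityMeasure ν] {B : Set X}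
    (hB : MeasurableSet B) (hpos : ν B ≠ 0) {f g : X → ℝ}
    (hf : Measurable f) (hg : Measurable g) (hf01 : ∀ x, f x ∈ Set.Icc (0 : ℝ) 1)
    (hg01 : ∀ x, g x ∈ Set.Icc (0 : ℝ) 1) {t : X → ℝ} (ht : Measurable t) {k δ q η : ℝ}
    (hk : 0 ≤ k) (hδ : 0 ≤ δ) {G : Set X} (hG : MeasurableSet G)
    (hclose : ∀ᵐ x ∂ν, x ∈ G → |f x - g x| ≤ k * t x)
    (hη : |∫ x, g x ∂ν[|B] - q| ≤ η) :
    |∫ x in B, f x ∂ν - ν.real B * q| ≤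
      (1 - (ν[|B]).real G) + ν.real {x | δ ≤ t x} + k * δ + η := by
  have := cond_isProbabilityMeasure hpos
  have h1 := abs_integral_sub_le_of_ae_close (ρ := ν[|B]) hf hg hf01 hg01 ht hk hδ hG
    (cond_absolutelyContinuous.ae_le hclose)
  have h2 := measureReal_mul_cond_le (ν := ν) hB {x | δ ≤ t x}
  have hb0 : 0 ≤ ν.real B := measureReal_nonneg
  have hb1 : ν.real B ≤ 1 := measureReal_le_one
  have hG1 : (ν[|B]).real G ≤ 1 := measureReal_le_one
  rw [← integral_cond_mul_measureReal hpos, ← mul_sub, abs_mul, abs_of_nonneg hb0]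
  have h3 : |∫ x, f x ∂ν[|B] - q| ≤
      (1 - (ν[|B]).real G) + (ν[|B]).real {x | δ ≤ t x} + k * δ + η := by
    have := abs_sub_le (∫ x, f x ∂ν[|B]) (∫ x, g x ∂ν[|B]) q
    linarith
  have hη0 : 0 ≤ η := (abs_nonneg _).trans hη
  have hkδ : 0 ≤ k * δ := mul_nonneg hk hδ
  calc ν.real B * |∫ x, f x ∂ν[|B] - q|
      ≤ ν.real B * ((1 - (ν[|B]).real G) + (ν[|B]).real {x | δ ≤ t x} + k * δ + η) := by gcongr
    _ = ν.real B * (1 - (ν[|B]).real G) + ν.real B * (ν[|B]).real {x | δ ≤ t x}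
        + ν.real B * (k * δ) + ν.real B * η := by ring
    _ ≤ _ := add_le_add (add_le_add (add_le_add
        (mul_le_of_le_one_left (by linarith) hb1) h2) (mul_le_of_le_one_left hkδ hb1))
        (mul_le_of_le_one_left hη0 hb1)

/-- Conditioning on a null set gives the zero measure, which is incompatible with a limit of one. -/
lemma eventually_cond_ne_zero {ν : ℕ → Measure X} {B G : ℕ → Set X}
    (h : Tendsto (fun l => (ν l)[|B l] (G l)) atTop (𝓝 1)) : ∀ᶠ l in atTop, ν l (B l) ≠ 0 := by
  filter_upwards [h.eventually_ne one_ne_zero] with l hl h0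
  exact hl (by rw [cond_eq_zero_of_meas_eq_zero h0]; simp)

lemma eventually_one_sub_measureReal_le {ρ : ℕ → Measure X} {G : ℕ → Set X}
    (h : Tendsto (fun l => ρ l (G l)) atTop (𝓝 1)) {η : ℝ} (hη : 0 < η) :
    ∀ᶠ l in atTop, 1 - (ρ l).real (G l) ≤ η := by
  have h1 := (ENNReal.tendsto_toReal ENNReal.one_ne_top).comp h
  have h2 := h1.eventually (lt_mem_nhds (b := (1 : ℝ≥0∞).toReal) (a := 1 - η) (by simpa using hη))
  filter_upwards [h2] with l hl
  have hl' : 1 - η < (ρ l).real (G l) := hl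
  linarith

lemma IsRareSequence.tendsto_measureReal {μ : Measure X} {A : ℕ → Set X}
    (hA : IsRareSequence μ A) :
    Tendsto (fun l => μ.real (A l)) atTop (𝓝 0) := by
  have h := (ENNReal.tendsto_toReal ENNReal.zero_ne_top).comp hA.tendsto_zero
  rwa [ENNReal.toReal_zero] at h

variable {μ : Measure X} [IsProbabilityMeasure μ] {T : X → X} {A Aret Aesc : ℕ → Set X}

lemma tendsto_integral_abs_entranceTransform_comp_sub (hT : Ergodic T μ)
    (hA : IsRareSequence μ A) (k : ℕ) {W : ℕ → X → ℝ} (hW : ∀ l, Measurable (W l))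
    (h01 : ∀ l x, W l x ∈ Set.Icc (0 : ℝ) 1) :
    Tendsto (fun l => ∫ x, |entranceTransform μ T (A l) k (W l) (T x) -
      entranceTransform μ T (A l) k (W l) x| ∂μ) atTop (𝓝 0) := by
  have h2 := hA.tendsto_measureReal.const_mul ((k : ℝ) + 1)
  rw [mul_zero] at h2
  exact squeeze_zero (fun l => integral_nonneg fun x => abs_nonneg _)
    (fun l => integral_abs_entranceTransform_comp_sub_le hT (hA.measurableSet l) (hA.pos l) k
      (hW l) (h01 l)) h2

/-- The return-time transform splits, up to a multiple of the distance of `ν_l` to `μ_{A_l}`, into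
an immediate-return part and an escaping part. -/
lemma SplitDelayConditions.eventually_abs_le (hT : Ergodic T μ) (hA : IsRareSequence μ A)
    (hret : ∀ l, MeasurableSet (Aret l)) (hesc : ∀ l, MeasurableSet (Aesc l))
    (hunion : ∀ l, A l = Aret l ∪ Aesc l) (hdisj : ∀ l, Disjoint (Aret l) (Aesc l))
    {θ : ℝ} (hprop : Tendsto (fun l => (μ[|A l]).real (Aesc l)) atTop (𝓝 θ))
    {ν : ℕ → AbsContProb μ} {τ : ℕ → X → ℕ} {𝔎 : Set (AbsContProb μ)} (h𝔎 : IsCompact 𝔎)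
    (hsplit : SplitDelayConditions μ T A Aret Aesc (fun l => (ν l).toMeasure) τ 𝔎)
    {η : ℝ} (hη : 0 < η) (hν : ∀ l, dist (ν l) (condProb μ (A l) (hA.pos l)) < η)
    (k : ℕ) {W : ℕ → X → ℝ} (hW : ∀ l, Measurable (W l))
    (h01 : ∀ l x, W l x ∈ Set.Icc (0 : ℝ) 1) :
    ∀ᶠ l in atTop, |∫ x, entranceTransform μ T (A l) k (W l) x ∂μ[|A l] -
      (1 - θ) * ∫ x, W l x ∂μ[|A l] - θ * ∫ x, entranceTransform μ T (A l) k (W l) x ∂μ|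
        ≤ 12 * η := by
  have hHm : ∀ l, Measurable (entranceTransform μ T (A l) k (W l)) := fun l =>
    measurable_entranceTransform hT.measurable (hA.measurableSet l) k (hW l)
  have hH01 : ∀ l x, entranceTransform μ T (A l) k (W l) x ∈ Set.Icc (0 : ℝ) 1 := fun l =>
    entranceTransform_mem_Icc (h01 l)
  have hcompact := eventually_forall_mem_compact_abs_integral_sub_le hT hHm hH01
    (tendsto_integral_abs_entranceTransform_comp_sub hT hA k hW h01) h𝔎 hη
  -- Chosen so that `k δ ≤ η`; the added one covers `k = 0`.
  set δ : ℝ := η / (k + 1) with hδ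
  have hδpos : 0 < δ := by positivity
  have hkδ : k * δ ≤ η := by
    rw [hδ, mul_div_assoc', div_le_iff₀ (by positivity)]
    nlinarith
  have htime : ∀ᶠ l in atTop,
      (ν l).toMeasure.real {x | δ ≤ μ.real (A l) * (τ l x : ℝ)} ≤ η := by
    have h1 := (ENNReal.tendsto_toReal ENNReal.zero_ne_top).comp (hsplit.time_negligible δ hδpos)
    filter_upwards [h1.eventually (gt_mem_nhds (show (0 : ℝ≥0∞).toReal < η by simpa using hη))] with l hl
    exact hl.le
  filter_upwards [hcompact, htime, eventually_cond_ne_zero hsplit.escape,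
    eventually_cond_ne_zero hsplit.early_return,
    eventually_one_sub_measureReal_le hsplit.escape hη,
    eventually_one_sub_measureReal_le hsplit.early_return hη,
    hsplit.return_image.eventually (gt_mem_nhds hη),
    Metric.tendsto_nhds.1 hprop η hη] with l hK hτ hescpos hretpos hesc1 hret1 htv hθl
  set H := entranceTransform μ T (A l) k (W l) with hH
  set κ := (ν l).toMeasure with hκ
  have hAm := hA.measurableSet l
  have hτm := hsplit.measurable_time l
  have hac : κ ≪ μ := (ν l).2.2
  have hprobA := cond_isProbabilityMeasure (hA.pos l)
  have hprobE := cond_isProbabilityMeasure hescpos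
  have hprobR := cond_isProbabilityMeasure hretpos
  have hfin : ∀ᵐ x ∂κ, hitTime T (A l) x ≠ ⊤ :=
    hac.ae_le (ae_hitTime_ne_top hT hAm (hA.pos l))
  have hhit := measurable_hitTime hT.measurable hAm
  have hτcast : Measurable fun x => ((τ l x : ℕ) : ℕ∞) :=
    (measurable_from_top (f := fun n : ℕ => (n : ℕ∞))).comp hτm
  have htm : Measurable fun x => μ.real (A l) * (τ l x : ℝ) :=
    ((measurable_from_top (f := fun n : ℕ => (n : ℝ))).comp hτm).const_mul _
  have hGesc : MeasurableSet {x | (τ l x : ℕ∞) < hitTime T (A l) x} :=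
    (hτcast.prodMk hhit) (MeasurableSet.of_discrete (s := {p : ℕ∞ × ℕ∞ | p.1 < p.2}))
  have hGret : MeasurableSet {x | hitTime T (A l) x ≤ (τ l x : ℕ∞)} :=
    (hhit.prodMk hτcast) (MeasurableSet.of_discrete (s := {p : ℕ∞ × ℕ∞ | p.1 ≤ p.2}))
  have hind := measurable_inducedMap hT.measurable hτm
  have hent := measurable_entranceMap hT.measurable hAm
  -- One `η` each for the exceptional set, the large delays, the factor `k δ`, and the comparison on
  -- the compact set. In `hR` below the last is replaced by the total variation bound for the
  -- entrance law.
  have hE : |∫ x in Aesc l, H x ∂κ - κ.real (Aesc l) * ∫ x, H x ∂μ| ≤ 4 * η := by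
    obtain ⟨κ', hκ', hκeq⟩ := hsplit.mem_compact l hescpos
    have h1 := hK κ' hκ'
    rw [hκeq, integral_map hind.aemeasurable (hHm l).aestronglyMeasurable] at h1
    have h2 := measureReal_mul_abs_integral_sub_le (hesc l) hescpos (hHm l) ((hHm l).comp hind)
      (hH01 l) (fun x => hH01 l _) htm (Nat.cast_nonneg k) hδpos.le hGesc
      (hfin.mono fun x hx hxG => abs_entranceTransform_sub_iterate_le (h01 l) hxG hx) h1
    linarith
  have hR : |∫ x in Aret l, H x ∂κ - κ.real (Aret l) * ∫ x, W l x ∂μ[|A l]| ≤ 4 * η := by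
    have hpm := Measure.isProbabilityMeasure_map (μ := κ[|Aret l]) hent.aemeasurable
    have h1 := abs_integral_sub_le_tvDist ((κ[|Aret l]).map (entranceMap T (A l))) (μ[|A l])
      (hW l) (h01 l)
    rw [integral_map hent.aemeasurable (hW l).aestronglyMeasurable] at h1
    have h2 := measureReal_mul_abs_integral_sub_le (hret l) hretpos (hHm l) ((hW l).comp hent)
      (hH01 l) (fun x => h01 l _) htm (Nat.cast_nonneg k) hδpos.le hGret
      (Eventually.of_forall fun x hxG => abs_entranceTransform_sub_entranceMap_le (h01 l) hxG) h1
    linarith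
  have htvν : tvDist κ (μ[|A l]) < η := hν l
  have hcomp := abs_measureReal_sub_le_tvDist κ (μ[|A l]) hAm.compl
  have hcompE := abs_measureReal_sub_le_tvDist κ (μ[|A l]) (hesc l)
  have hcompR := abs_measureReal_sub_le_tvDist κ (μ[|A l]) (hret l)
  have hcompH := abs_integral_sub_le_tvDist κ (μ[|A l]) (hHm l) (hH01 l)
  have hself : (μ[|A l]).real (A l) = 1 := by
    rw [measureReal_def, cond_apply_self (hA.pos l) (measure_ne_top μ _)]
    simp
  have hzero : (μ[|A l]).real (A l)ᶜ = 0 := by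
    rw [probReal_compl_eq_one_sub hAm, hself, sub_self]
  have hsum : (μ[|A l]).real (Aret l) + (μ[|A l]).real (Aesc l) = 1 := by
    rw [← measureReal_union (hdisj l) (hesc l), ← hunion l, hself]
  have hHi : Integrable H κ := integrable_of_mem_Icc (hHm l) (hH01 l)
  -- The measure `κ` need not be carried by `A l`; the mass it leaves outside is bounded by its
  -- distance to `μ[|A l]`.
  have hdec : ∫ x, H x ∂κ =
      (∫ x in Aret l, H x ∂κ + ∫ x in Aesc l, H x ∂κ) + ∫ x in (A l)ᶜ, H x ∂κ := by
    rw [← setIntegral_union (hdisj l) (hesc l) hHi.integrableOn hHi.integrableOn, ← hunion l,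
      integral_add_compl hAm hHi]
  have hrest : |∫ x in (A l)ᶜ, H x ∂κ| ≤ κ.real (A l)ᶜ := by
    have h1 := norm_setIntegral_le_of_norm_le_const (μ := κ) (s := (A l)ᶜ) (f := H) (C := 1)
      (measure_lt_top _ _) fun x _ => by
        rw [Real.norm_of_nonneg (hH01 l x).1]
        exact (hH01 l x).2
    simpa using h1
  have hq := integral_mem_Icc (ν := μ) (hHm l) (hH01 l)
  have hw := integral_mem_Icc (ν := μ[|A l]) (hW l) (h01 l)
  rw [Real.dist_eq] at hθl
  -- Half an `η` from replacing `κ` by `μ[|A l]`, and one from the convergence of the proportions to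
  -- `θ`.
  have hqE : |(κ.real (Aesc l) - θ) * ∫ x, H x ∂μ| ≤ 3 / 2 * η := by
    rw [abs_mul, abs_of_nonneg hq.1]
    refine (mul_le_of_le_one_right (abs_nonneg _) hq.2).trans ?_
    have := abs_sub_le (κ.real (Aesc l)) ((μ[|A l]).real (Aesc l)) θ
    linarith
  have hwR : |(κ.real (Aret l) - (1 - θ)) * ∫ x, W l x ∂μ[|A l]| ≤ 3 / 2 * η := by
    rw [abs_mul, abs_of_nonneg hw.1]
    refine (mul_le_of_le_one_right (abs_nonneg _) hw.2).trans ?_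
    have h1 := abs_sub_le (κ.real (Aret l)) ((μ[|A l]).real (Aret l)) (1 - θ)
    have h2 : (μ[|A l]).real (Aret l) - (1 - θ) = -((μ[|A l]).real (Aesc l) - θ) := by linarith
    rw [h2, abs_neg] at h1
    linarith
  rw [hzero, sub_zero] at hcomp
  rw [sub_mul] at hqE hwR
  have h5 := (le_abs_self _).trans hcomp
  rw [abs_le] at hE hR hcompH hrest hqE hwR ⊢
  -- The total is `4 + 4` for the two parts, `3/2 + 3/2` for their weights, `1/2` for replacing
  -- `μ[|A l]` by `κ`, and `1/2` for the mass outside `A l`.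
  constructor <;> linarith

/-- Hypothesis under which the return process has a compound exponential limit: for every `ε` the
splitting conditions hold for measures which are `ε`-close to `μ_{A_l}`. -/
def ApproximatelySplits (μ : Measure X) [IsProbabilityMeasure μ] (T : X → X)
    (A Aret Aesc : ℕ → Set X) (hA : IsRareSequence μ A) : Prop :=
  ∀ ε : ℝ, 0 < ε → ∃ (ν : ℕ → AbsContProb μ) (τ : ℕ → X → ℕ) (𝔎 : Set (AbsContProb μ)),
    (∀ l, dist (ν l) (condProb μ (A l) (hA.pos l)) < ε) ∧ IsCompact 𝔎 ∧
      SplitDelayConditions μ T A Aret Aesc (fun l => (ν l).toMeasure) τ 𝔎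

/-- The difference quotient at zero of `x ↦ e^{kx}`. -/
lemma tendsto_exp_mul_sub_one_div (k : ℝ) {a : ℕ → ℝ} (ha : ∀ l, a l ≠ 0)
    (ha0 : Tendsto a atTop (𝓝 0)) :
    Tendsto (fun l => (Real.exp (k * a l) - 1) / a l) atTop (𝓝 k) := by
  have h1 : HasDerivAt (fun x : ℝ => Real.exp (k * x)) k 0 := by
    simpa using ((hasDerivAt_id (0 : ℝ)).const_mul k).exp
  have h2 := h1.tendsto_slope.comp
    (tendsto_nhdsWithin_iff.2 ⟨ha0, Eventually.of_forall fun l => ha l⟩)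
  refine h2.congr fun l => ?_
  simp [slope_def_field]

/-- The relations `p = v - c q` and `p ≈ (1-θ) v + θ q` give `(c + θ) q ≈ θ v`; as `c → k` and `θ >
0` this fixes the limit of `q`, and then that of `p`. -/
lemma tendsto_integral_entranceTransform (hT : Ergodic T μ) (hA : IsRareSequence μ A)
    (hret : ∀ l, MeasurableSet (Aret l)) (hesc : ∀ l, MeasurableSet (Aesc l))
    (hunion : ∀ l, A l = Aret l ∪ Aesc l) (hdisj : ∀ l, Disjoint (Aret l) (Aesc l))
    {θ : ℝ} (hθ : 0 < θ) (hprop : Tendsto (fun l => (μ[|A l]).real (Aesc l)) atTop (𝓝 θ))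
    (hsplit : ApproximatelySplits μ T A Aret Aesc hA) (k : ℕ) {W : ℕ → X → ℝ}
    (hW : ∀ l, Measurable (W l)) (h01 : ∀ l x, W l x ∈ Set.Icc (0 : ℝ) 1) {w : ℝ}
    (hw : Tendsto (fun l => ∫ x, W l x ∂μ[|A l]) atTop (𝓝 w)) :
    Tendsto (fun l => ∫ x, entranceTransform μ T (A l) k (W l) x ∂μ[|A l]) atTop
      (𝓝 (compoundExpLaplace θ k * w)) := by
  set p : ℕ → ℝ := fun l => ∫ x, entranceTransform μ T (A l) k (W l) x ∂μ[|A l] with hp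
  set q : ℕ → ℝ := fun l => ∫ x, entranceTransform μ T (A l) k (W l) x ∂μ with hq
  set v : ℕ → ℝ := fun l => ∫ x, W l x ∂μ[|A l] with hv
  set c : ℕ → ℝ := fun l => (Real.exp (k * μ.real (A l)) - 1) / μ.real (A l) with hc
  have hane : ∀ l, μ.real (A l) ≠ 0 := fun l =>
    (measureReal_ne_zero_iff (measure_ne_top μ _)).2 (hA.pos l)
  have hclim : Tendsto c atTop (𝓝 k) := tendsto_exp_mul_sub_one_div k hane hA.tendsto_measureReal
  have hc0 : ∀ l, 0 ≤ c l := fun l => div_nonneg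
    (sub_nonneg.2 (Real.one_le_exp (by positivity))) measureReal_nonneg
  have hkac : ∀ l, p l = v l - c l * q l := by
    intro l
    have h1 := exp_sub_one_mul_integral_entranceTransform hT (hA.measurableSet l) (hA.pos l) k
      (hW l) (h01 l)
    have h2 : c l * q l = v l - p l := by
      rw [hc]
      simp only
      rw [div_mul_eq_mul_div, div_eq_iff (hane l), mul_comm (v l - p l)]
      exact h1
    linarith
  have hdiff : Tendsto (fun l => p l - (1 - θ) * v l - θ * q l) atTop (𝓝 0) := by
    rw [Metric.tendsto_nhds]
    intro ε hε
    -- The error `12 · ε/24 = ε/2` is strictly below `ε`.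
    obtain ⟨ν, τ, 𝔎, hν, h𝔎, hs⟩ := hsplit (ε / 24) (by positivity)
    filter_upwards [hs.eventually_abs_le hT hA hret hesc hunion hdisj hprop h𝔎
      (by positivity : 0 < ε / 24) hν k hW h01] with l hl
    rw [Real.dist_eq, sub_zero]
    exact lt_of_le_of_lt hl (by linarith)
  have hpos : (0 : ℝ) < k + θ := by positivity
  have hqlim : Tendsto q atTop (𝓝 (θ * w / (k + θ))) := by
    have h1 := ((hw.const_mul θ).sub hdiff).div (hclim.add_const θ) hpos.ne'
    rw [sub_zero] at h1
    refine h1.congr fun l => ?_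
    have h2 : c l + θ ≠ 0 := by
      have := hc0 l
      positivity
    rw [Pi.div_apply, div_eq_iff h2, hkac l]
    ring
  have hplim := hw.sub (hclim.mul hqlim)
  have hval : w - k * (θ * w / (k + θ)) = compoundExpLaplace θ k * w := by
    have h3 : θ + (k : ℝ) ≠ 0 := by positivity
    rw [compoundExpLaplace]
    field_simp
    ring
  rw [hval] at hplim
  exact hplim.congr fun l => (hkac l).symm

/-- Induction on the number of coordinates: `W` is the monomial in the shifted exponents, so each
step splits off the factor of the first coordinate. The product form of the limit is the asymptotic
independence. -/
lemma tendsto_integral_expMonomial (hT : Ergodic T μ) (hA : IsRareSequence μ A)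
    (hret : ∀ l, MeasurableSet (Aret l)) (hesc : ∀ l, MeasurableSet (Aesc l))
    (hunion : ∀ l, A l = Aret l ∪ Aesc l) (hdisj : ∀ l, Disjoint (Aret l) (Aesc l))
    {θ : ℝ} (hθ : 0 < θ) (hprop : Tendsto (fun l => (μ[|A l]).real (Aesc l)) atTop (𝓝 θ))
    (hsplit : ApproximatelySplits μ T A Aret Aesc hA) (d : ℕ) (k : ℕ → ℕ) :
    Tendsto (fun l => ∫ x, expMonomial d k (scaledHitProcess μ T (A l) x) ∂μ[|A l]) atTop
      (𝓝 (∏ j ∈ Finset.range d, compoundExpLaplace θ (k j))) := by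
  induction d generalizing k with
  | zero =>
    have hprob : ∀ l, IsProbabilityMeasure (μ[|A l]) := fun l =>
      cond_isProbabilityMeasure (hA.pos l)
    simp [expMonomial]
  | succ d ih =>
    simp only [expMonomial_succ_scaledHitProcess]
    rw [Finset.prod_range_succ', mul_comm]
    exact tendsto_integral_entranceTransform hT hA hret hesc hunion hdisj hθ hprop hsplit (k 0)
      (fun l => (continuous_expMonomial d _).measurable.comp
        (measurable_scaledHitProcess μ hT.measurable (hA.measurableSet l)))
      (fun l x => expMonomial_mem_Icc _ _ _) (ih fun j => k (j + 1))

/-- Approximate splitting implies convergence of the return process. -/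
theorem ApproximatelySplits.tendstoInDistribution {hA : IsRareSequence μ A}
    (hsplit : ApproximatelySplits μ T A Aret Aesc hA) (hT : Ergodic T μ)
    (hret : ∀ l, MeasurableSet (Aret l)) (hesc : ∀ l, MeasurableSet (Aesc l))
    (hunion : ∀ l, A l = Aret l ∪ Aesc l) (hdisj : ∀ l, Disjoint (Aret l) (Aesc l))
    {θ : ℝ} (hθ : θ ∈ Set.Ioo (0 : ℝ) 1)
    (hprop : Tendsto (fun l => (μ[|A l]).real (Aesc l)) atTop (𝓝 θ))
    {Ω : Type*} [MeasurableSpace Ω] {P : Measure Ω} [IsProbabilityMeasure P]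
    {Φ : Ω → ℕ → ℝ≥0∞} (hΦ : IsIIDCompoundExp P θ Φ) :
    TendstoInDistribution (fun l => scaledHitProcess μ T (A l)) atTop Φ
      (fun l => (condProb μ (A l) (hA.pos l)).toMeasure) P where
  forall_aemeasurable l :=
    (measurable_scaledHitProcess μ hT.measurable (hA.measurableSet l)).aemeasurable
  aemeasurable_limit := (measurable_pi_lambda _ hΦ.measurable).aemeasurable
  tendsto := by
    refine tendsto_of_tendsto_integral_expMonomial fun d k => ?_
    simp only [ProbabilityMeasure.coe_mk]
    rw [integral_map (measurable_pi_lambda _ hΦ.measurable).aemeasurable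
      (continuous_expMonomial d k).aestronglyMeasurable, hΦ.integral_expMonomial hθ]
    refine (tendsto_integral_expMonomial hT hA hret hesc hunion hdisj hθ.1 hprop hsplit d k).congr
      fun l => ?_
    rw [integral_map
      (measurable_scaledHitProcess μ hT.measurable (hA.measurableSet l)).aemeasurable
      (continuous_expMonomial d k).aestronglyMeasurable]
    rfl

end Splitting

end

end RareEvents

theorem mainTheorem5
    {X : Type*} [MeasurableSpace X] (μ : Measure X) [IsProbabilityMeasure μ]
    (T : X → X) (hT : Ergodic T μ)
    (A : ℕ → Set X) (hA : RareEvents.IsRareSequence μ A)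
    (Aret Aesc : ℕ → Set X)
    (hret : ∀ l, MeasurableSet (Aret l)) (hesc : ∀ l, MeasurableSet (Aesc l))
    (hunion : ∀ l, A l = Aret l ∪ Aesc l) (hdisj : ∀ l, Disjoint (Aret l) (Aesc l))
    (θ : ℝ) (hθ : θ ∈ Set.Ioo (0 : ℝ) 1)
    (hprop : Tendsto (fun l => (μ[|A l]).real (Aesc l)) atTop (𝓝 θ))
    {Ω : Type*} [MeasurableSpace Ω] (P : Measure Ω) [IsProbabilityMeasure P]
    (Φ : Ω → ℕ → ℝ≥0∞) (hΦ : RareEvents.IsIIDCompoundExp P θ Φ) :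
    ((∃ (τ : ℕ → X → ℕ) (𝔎 : Set (RareEvents.AbsContProb μ)), IsCompact 𝔎 ∧
        RareEvents.SplitDelayConditions μ T A Aret Aesc (fun l => μ[|A l]) τ 𝔎) →
      TendstoInDistribution (fun l => RareEvents.scaledHitProcess μ T (A l)) atTop Φ
        (fun l => (RareEvents.condProb μ (A l) (hA.pos l)).toMeasure) P) ∧
    ((∀ ε : ℝ, 0 < ε →
        ∃ (ν : ℕ → RareEvents.AbsContProb μ) (τ : ℕ → X → ℕ)
          (𝔎 : Set (RareEvents.AbsContProb μ)),
          (∀ l, dist (ν l) (RareEvents.condProb μ (A l) (hA.pos l)) < ε) ∧ IsCompact 𝔎 ∧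
          RareEvents.SplitDelayConditions μ T A Aret Aesc (fun l => (ν l).toMeasure) τ 𝔎) →
      TendstoInDistribution (fun l => RareEvents.scaledHitProcess μ T (A l)) atTop Φ
        (fun l => (RareEvents.condProb μ (A l) (hA.pos l)).toMeasure) P) := by
  have hb : RareEvents.ApproximatelySplits μ T A Aret Aesc hA →
      TendstoInDistribution (fun l => RareEvents.scaledHitProcess μ T (A l)) atTop Φ
        (fun l => (RareEvents.condProb μ (A l) (hA.pos l)).toMeasure) P := fun h =>
    h.tendstoInDistribution hT hret hesc hunion hdisj hθ hprop hΦ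
  refine ⟨?_, hb⟩
  rintro ⟨τ, 𝔎, h𝔎, hs⟩
  -- Part (a) is the case of (b) with `ν_l = μ_{A_l}` for every `ε`, at distance zero.
  exact hb fun ε hε => ⟨fun l => RareEvents.condProb μ (A l) (hA.pos l), τ, 𝔎,
    fun l => by rwa [dist_self], h𝔎, hs⟩
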